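/- **Definitions.** A *centred permutation* of length $n$ is a permutation of length $n+1$ in which one point is designated as the origin; removing the origin gives its *underlying permutation*, of length $n$. We write $\pi^\circ\le\sigma^\circ$ if $\pi^\circ$ embeds in $\sigma^\circ$ as a pattern in such a way that the origins match. A *centred permutation class* is a non-empty set of centred permutations that is downward closed under $\le$. The *box sum* $\pi^\circ\boxplus\sigma^\circ$ is obtained by inflating the origin of $\sigma^\circ$ by a copy of $\pi^\circ$, whose origin becomes the origin of the sum. The *$\boxplus$-closure* of a set $S$ of centred permutations is the smallest centred permutation class that contains $S$ and is closed under $\boxplus$. A *pin word* (finite and non-empty) or *pin sequence* (infinite) is a numeral from $\{1,2,3,4\}$ followed by letters from $\{u,d,l,r\}$ (up, down, left, right) that alternate between vertical ($u,d$) and horizontal ($l,r$). It is drawn in the plane as follows: $p_0$ is the origin; $p_1$ is placed in the quadrant (numbered anticlockwise) given by the numeral; for $k\ge 2$ the point $p_k$ is placed outside the bounding rectangle of $p_0,\dots,p_{k-1}$, in the direction given by the $k$th symbol, so that its other coordinate separates $p_{k-1}$ from $p_0,\dots,p_{k-2}$. For a pin word $v$ of length $n$, let $\pi^\circ_v$ be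 the centred permutation of length $n$ formed by $p_0,\dots,p_n$, with origin $p_0$. For a pin sequence $w$ and $1\le i\le j$, the *pin factor* $w_{i,j}$ is the contiguous subword of $w$ in places $i,\dots,j$ with its first symbol replaced by the number of the quadrant that contains $p_i$. A pin word $v$ is a *recurrent pin factor* of $w$ if for every $n$ there are $j\ge i\ge n$ with $w_{i,j}=v$. The *centred pin class* $\mathcal C^\circ_w$ is the set of all centred permutations contained in $\pi^\circ_{w_{1,n}}$ for some $n\ge1$; the *uncentred pin class* $\mathcal C_w$ is the set of underlying permutations of its members; the *$\boxplus$-interior* $\mathcal C^{\boxplus}_w$ is the $\boxplus$-closure of $\{\pi^\circ_v : v \text{ is a recurrent pin factor of } w\}$. A set of (centred or uncentred) permutations with $C_n$ members of length $n$ has *proper growth rate* $\rho\in[0,\infty)$ if $\liminf_{n\to\infty} C_n^{1/n}=\limsup_{n\to\infty} C_n^{1/n}=\rho$. **Theorem.** Let $w$ be any infinite pin sequence. Then $\mathcal C^\circ_w$, $\mathcal C_w$ and $\mathcal C^{\boxplus}_w$ all have a proper growth rate, and the three growth rates are equal. -/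

import Mathlib

open Filter
open scoped NNReal ENNReal

namespace PinClasses

/-! ### Permutations and centred permutations -/

/-- An (uncentred) permutation of some finite length. -/
structure Permutation where
  length : ℕ
  perm : Equiv.Perm (Fin length)

/-- A centred permutation of length `n`: a permutation of length `n + 1` (the filled-in
permutation) one of whose points, the one in position `origin`, is designated as the origin. -/
structure CentredPerm where
  length : ℕ
  perm : Equiv.Perm (Fin (length + 1))
  origin : Fin (length + 1)

/-- Containment of centred permutations: the filled-in permutation of `π` embeds as a pattern in
that of `σ`, in such a way that the origins match up. -/
def CentredPerm.Contained (π σ : CentredPerm) : Prop :=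
  ∃ f : Fin (π.length + 1) ↪o Fin (σ.length + 1),
    (∀ i j, π.perm i < π.perm j ↔ σ.perm (f i) < σ.perm (f j)) ∧ f π.origin = σ.origin

/-- The underlying permutation of a centred permutation: the origin is removed (and the remaining
positions and values are relabelled increasingly). -/
def CentredPerm.underlying (σ : CentredPerm) : Permutation where
  length := σ.length
  perm :=
    ((finSuccAboveEquiv σ.origin).trans
      (σ.perm.subtypeEquiv (p := fun i => i ≠ σ.origin) (q := fun v => v ≠ σ.perm σ.origin)
        (fun _ => not_congr σ.perm.apply_eq_iff_eq.symm))).trans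
      (finSuccAboveEquiv (σ.perm σ.origin)).symm

/-- The centred permutation read off from `n + 1` points of a plane, the `i`-th of which has
coordinates `x i` and `y i` (pairwise distinct `x`-coordinates, pairwise distinct
`y`-coordinates), the point with index `o` being the origin. Here `Tuple.sort x a` is the index
of the `a`-th point from the left and `(Tuple.sort y).symm i` is the height (rank from the
bottom) of the `i`-th point. -/
def patternOf {α β : Type*} [LinearOrder α] [LinearOrder β] {n : ℕ}
    (x : Fin (n + 1) → α) (y : Fin (n + 1) → β) (o : Fin (n + 1)) : CentredPerm where
  length := n
  perm := (Tuple.sort x).trans (Tuple.sort y).symm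
  origin := (Tuple.sort x).symm o

/-- A labelling of the points of a box sum: the points of `π` including its origin, then the
points of `σ` other than its origin. -/
def boxIndex (m n : ℕ) : Fin (m + n + 1) ≃ Fin (m + 1) ⊕ Fin n :=
  (finCongr (by omega)).trans finSumFinEquiv.symm

/-- The box sum `π ⊞ σ`: the origin of `σ` is inflated by a copy of `π`, and the origin of that
copy is the new origin. Horizontal and vertical positions are compared lexicographically: first
the position in `σ` (that of the origin of `σ`, for the points of `π`), then the position
inside the inflated origin. -/
def CentredPerm.boxSum (π σ : CentredPerm) : CentredPerm :=
  patternOf (n := π.length + σ.length)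
    (fun i => Sum.elim
      (fun a => (toLex (σ.origin, a) : Fin (σ.length + 1) ×ₗ Fin (π.length + 1)))
      (fun b => toLex (σ.origin.succAbove b, 0))
      (boxIndex π.length σ.length i))
    (fun i => Sum.elim
      (fun a => (toLex (σ.perm σ.origin, π.perm a) : Fin (σ.length + 1) ×ₗ Fin (π.length + 1)))
      (fun b => toLex (σ.perm (σ.origin.succAbove b), 0))
      (boxIndex π.length σ.length i))
    ((boxIndex π.length σ.length).symm (Sum.inl π.origin))

/-- A centred permutation class: a non-empty set of centred permutations which is downward
closed under containment. -/
def IsCentredClass (C : Set CentredPerm) : Prop :=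
  C.Nonempty ∧ ∀ π σ : CentredPerm, π.Contained σ → σ ∈ C → π ∈ C

/-- A set of centred permutations closed under the box sum. -/
def IsBoxClosed (C : Set CentredPerm) : Prop :=
  ∀ π ∈ C, ∀ σ ∈ C, π.boxSum σ ∈ C

/-- The `⊞`-closure: the smallest `⊞`-closed centred permutation class containing `S`. -/
def boxClosure (S : Set CentredPerm) : Set CentredPerm :=
  ⋂₀ {C | IsCentredClass C ∧ IsBoxClosed C ∧ S ⊆ C}

/-! ### Enumeration and growth rates -/

/-- The enumeration sequence of a set of centred permutations. -/
noncomputable def centredEnum (C : Set CentredPerm) (n : ℕ) : ℕ :=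
  {σ | σ ∈ C ∧ σ.length = n}.ncard

/-- The enumeration sequence of a set of uncentred permutations. -/
noncomputable def uncentredEnum (C : Set Permutation) (n : ℕ) : ℕ :=
  {σ | σ ∈ C ∧ σ.length = n}.ncard

/-- There are only finitely many centred permutations of each length. -/
theorem finite_centred (C : Set CentredPerm) (n : ℕ) :
    {σ | σ ∈ C ∧ σ.length = n}.Finite := by
  refine (Set.finite_range (fun p : Equiv.Perm (Fin (n + 1)) × Fin (n + 1) =>
    (⟨n, p.1, p.2⟩ : CentredPerm))).subset ?_
  rintro ⟨m, e, o⟩ ⟨-, rfl⟩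
  exact ⟨(e, o), rfl⟩

/-- There are only finitely many permutations of each length. -/
theorem finite_uncentred (C : Set Permutation) (n : ℕ) :
    {σ | σ ∈ C ∧ σ.length = n}.Finite := by
  refine (Set.finite_range (fun p : Equiv.Perm (Fin n) => (⟨n, p⟩ : Permutation))).subset ?_
  rintro ⟨m, e⟩ ⟨-, rfl⟩
  exact ⟨e, rfl⟩

/-- The upper growth rate of a sequence, as an extended non-negative real. -/
noncomputable def upperGrowthRate (c : ℕ → ℕ) : ℝ≥0∞ :=
  limsup (fun n => (c n : ℝ≥0∞) ^ (1 / (n : ℝ))) atTop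

/-- The lower growth rate of a sequence, as an extended non-negative real. -/
noncomputable def lowerGrowthRate (c : ℕ → ℕ) : ℝ≥0∞ :=
  liminf (fun n => (c n : ℝ≥0∞) ^ (1 / (n : ℝ))) atTop

/-- The sequence `c` has proper growth rate `ρ`: the lower and the upper growth rate are both
equal to the (finite) number `ρ`. -/
def HasGrowthRate (c : ℕ → ℕ) (ρ : ℝ≥0) : Prop :=
  lowerGrowthRate c = ρ ∧ upperGrowthRate c = ρ

/-! ### Pin sequences and pin words -/

/-- The four quadrants, numbered anticlockwise. -/
inductive Quadrant
  | q1 | q2 | q3 | q4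

/-- The letters up, down, left and right. -/
inductive Dir
  | u | d | l | r

/-- The alignment of a letter: `true` for vertical, `false` for horizontal. -/
def Dir.vertical : Dir → Bool
  | .u => true
  | .d => true
  | .l => false
  | .r => false

/-- The point of the given quadrant at which the first pin is placed. -/
def Quadrant.firstPoint : Quadrant → ℤ × ℤ
  | .q1 => (2, 2)
  | .q2 => (-2, 2)
  | .q3 => (-2, -2)
  | .q4 => (2, -2)

/-- The quadrant of a point which is not on the axes. -/
def quadrantOf (p : ℤ × ℤ) : Quadrant :=
  if 0 < p.1 then (if 0 < p.2 then .q1 else .q4) else (if 0 < p.2 then .q2 else .q3)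

/-- An infinite pin sequence: a numeral followed by letters which alternate between horizontal
and vertical alignment. The symbol in place `k + 2` is `letter k`. -/
structure PinSequence where
  first : Quadrant
  letter : ℕ → Dir
  alternates : ∀ k, (letter k).vertical ≠ (letter (k + 1)).vertical

/-- A finite (non-empty) pin word: a numeral followed by a finite list of letters which alternate
between horizontal and vertical alignment. -/
structure PinWord where
  first : Quadrant
  letters : List Dir
  alternates : letters.IsChain (fun a b => a.vertical ≠ b.vertical)

/-- The points `p 0, p 1, p 2, …` drawn for the numeral `q` followed by the letters
`s 0, s 1, …`. The origin is `p 0`, and `p 1` lies in quadrant `q`. The point `p (k + 2)` lies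
beyond all the previous ones in the direction `s k` (all of them have coordinates of absolute
value at most `2 * k + 2`); its other coordinate is that of `p (k + 1)` moved by one unit
towards the origin, and so separates `p (k + 1)` from all points before it. -/
def pinPoint (q : Quadrant) (s : ℕ → Dir) : ℕ → ℤ × ℤ
  | 0 => (0, 0)
  | 1 => q.firstPoint
  | k + 2 =>
    let p := pinPoint q s (k + 1)
    match s k with
    | .u => (p.1 - p.1.sign, 2 * (k : ℤ) + 4)
    | .d => (p.1 - p.1.sign, -(2 * (k : ℤ) + 4))
    | .l => (-(2 * (k : ℤ) + 4), p.2 - p.2.sign)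
    | .r => (2 * (k : ℤ) + 4, p.2 - p.2.sign)

/-- The centred pin permutation of a pin word of length `n`, read off from the points
`p 0, …, p n` with `p 0` as the origin. (Only the letters of the word matter for these points;
the default value of `getD` is never used.) -/
def PinWord.pinPerm (v : PinWord) : CentredPerm :=
  let p : Fin (v.letters.length + 1 + 1) → ℤ × ℤ :=
    fun i => pinPoint v.first (fun k => v.letters.getD k Dir.u) i
  patternOf (fun i => (p i).1) (fun i => (p i).2) 0

/-- The letters in places `i + 2, …, i + m + 1` of a pin sequence alternate. -/
theorem PinSequence.isChain_letters (w : PinSequence) (i m : ℕ) :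
    (List.ofFn fun t : Fin m => w.letter (i + t)).IsChain
      (fun a b => a.vertical ≠ b.vertical) := by
  rw [List.isChain_iff_getElem]
  intro k hk
  simpa [add_assoc] using w.alternates (i + k)

/-- The initial pin word of length `m + 1` of a pin sequence. -/
def PinSequence.initialWord (w : PinSequence) (m : ℕ) : PinWord where
  first := w.first
  letters := List.ofFn fun t : Fin m => w.letter t
  alternates := by simpa using w.isChain_letters 0 m

/-- The pin factor of length `m + 1` of `w` that occupies the places `i + 1, …, i + m + 1`: the
symbol in place `i + 1` is replaced by the quadrant that contains the point `p (i + 1)`. -/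
def PinSequence.factor (w : PinSequence) (i m : ℕ) : PinWord where
  first := quadrantOf (pinPoint w.first w.letter (i + 1))
  letters := List.ofFn fun t : Fin m => w.letter (i + t)
  alternates := w.isChain_letters i m

/-- `v` is a recurrent pin factor of `w`: it occurs in `w` arbitrarily late. -/
def PinSequence.IsRecurrentFactor (w : PinSequence) (v : PinWord) : Prop :=
  ∀ N : ℕ, ∃ i ≥ N, ∃ m, w.factor i m = v

/-- The centred pin class of `w`: all centred permutations contained in the pin permutation of
some initial pin word of `w`. -/
def PinSequence.centredPinClass (w : PinSequence) : Set CentredPerm :=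
  {σ | ∃ m, σ.Contained (w.initialWord m).pinPerm}

/-- The uncentred pin class of `w`: the underlying permutations of its centred pin class. -/
def PinSequence.pinClass (w : PinSequence) : Set Permutation :=
  CentredPerm.underlying '' w.centredPinClass

/-- The `⊞`-interior of the pin class of `w`: the `⊞`-closure of the set of pin permutations of
the recurrent pin factors of `w`. -/
def PinSequence.boxInterior (w : PinSequence) : Set CentredPerm :=
  boxClosure {σ | ∃ v, w.IsRecurrentFactor v ∧ v.pinPerm = σ}

end PinClasses

/-! Write `a`, `b`, `u` for the enumerations of the `⊞`-interior, the centred class and the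
uncentred class. Geometry: whether `p j` lies left or right of, above or below, an earlier `p i`
depends only on the quadrant of `p j`, unless `j = i + 1` (`IsZigzag.lt_iff`). Hence index sets
separated by a missing index form a box sum (`box_pts_iso`), and a contiguous block of indices draws
the corresponding pin factor (`factor_iso`). Deletion: there are finitely many pin words of each
length, so all late factors of length `m + 1` are recurrent. Deleting a bounded set of early points
and one residue class of indices modulo `m + 2` leaves a box sum of patterns contained in such
factors, hence a member of the interior. By pigeonhole the residue class can be chosen to cost at
most `n / (m + 2)` points (`exists_deletion`). Counting: a member of the centred class is recovered
from the positions and values of the deleted points, their pattern together with the origin, and the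
remaining pattern. So `b n` is at most the sum over `j ≤ n / (m + 2) + K` of `(n + 1).choose j ^ 2 *
b j * a (n - j)`. Since `b j ≤ 16 ^ (j + 1)`, letting `m` grow shows that `log (b n) - log (a n)` is
`o(n)`. Existence: box sums with known lengths and known origin of the first summand can be
cancelled, so `a m * a n ≤ (m + 1) * a (m + n)`, and Fekete's lemma gives a limit for `log (a n) /
n`. Finally `u n ≤ b n ≤ (n + 1) ^ 2 * u n`, as only the place of the origin is forgotten. -/

namespace PinClasses

/-! ### Relational configurations -/

/-- A set of points with two relations (left of, below) and a distinguished origin. -/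
structure Config where
  carrier : Type
  X : carrier → carrier → Prop
  Y : carrier → carrier → Prop
  o : carrier

namespace Config

/-- Origin-preserving embedding of configurations. -/
def Le (A B : Config) : Prop :=
  ∃ f : A.carrier → B.carrier, Function.Injective f ∧ (∀ i j, A.X i j ↔ B.X (f i) (f j)) ∧
    (∀ i j, A.Y i j ↔ B.Y (f i) (f j)) ∧ f A.o = B.o

/-- Origin-preserving isomorphism of configurations. -/
def Iso (A B : Config) : Prop :=
  ∃ f : A.carrier ≃ B.carrier, (∀ i j, A.X i j ↔ B.X (f i) (f j)) ∧
    (∀ i j, A.Y i j ↔ B.Y (f i) (f j)) ∧ f A.o = B.o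

theorem Iso.le {A B : Config} (h : Iso A B) : Le A B := by
  obtain ⟨f, h⟩ := h
  exact ⟨f, f.injective, h⟩

theorem Iso.symm {A B : Config} (h : Iso A B) : Iso B A := by
  obtain ⟨f, hX, hY, ho⟩ := h
  exact ⟨f.symm, fun i j => by simp [hX], fun i j => by simp [hY], by simp [← ho]⟩

theorem Iso.trans {A B C : Config} (h : Iso A B) (h' : Iso B C) : Iso A C := by
  obtain ⟨f, hX, hY, ho⟩ := h
  obtain ⟨g, hX', hY', ho'⟩ := h'
  exact ⟨f.trans g, fun i j => by simp [hX, hX'], fun i j => by simp [hY, hY'],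
    by simp [ho, ho']⟩

theorem Le.trans {A B C : Config} (h : Le A B) (h' : Le B C) : Le A C := by
  obtain ⟨f, hf, hX, hY, ho⟩ := h
  obtain ⟨g, hg, hX', hY', ho'⟩ := h'
  exact ⟨g ∘ f, hg.comp hf, fun i j => by simp [hX, hX'], fun i j => by simp [hY, hY'],
    by simp [ho, ho']⟩

/-- The configuration of points with given coordinates. -/
def ofFun {ι : Type} {α β : Type*} [LT α] [LT β] (x : ι → α) (y : ι → β) (o : ι) : Config :=
  ⟨ι, fun i j => x i < x j, fun i j => y i < y j, o⟩

theorem ofFun_iso {ι κ : Type} {α β α' β' : Type*} [LT α] [LT β] [LT α'] [LT β']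
    {x : ι → α} {y : ι → β} {o : ι} {x' : κ → α'} {y' : κ → β'} {o' : κ} (e : ι ≃ κ)
    (hx : ∀ i j, x i < x j ↔ x' (e i) < x' (e j)) (hy : ∀ i j, y i < y j ↔ y' (e i) < y' (e j))
    (ho : e o = o') : Iso (ofFun x y o) (ofFun x' y' o') :=
  ⟨e, hx, hy, ho⟩

/-- The box sum of configurations. -/
def box (A B : Config) : Config where
  carrier := A.carrier ⊕ {j : B.carrier // j ≠ B.o}
  X := Sum.elim (fun a => Sum.elim (fun b => A.X a b) (fun j => B.X B.o j))
    (fun i => Sum.elim (fun _ => B.X i B.o) (fun j => B.X i j))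
  Y := Sum.elim (fun a => Sum.elim (fun b => A.Y a b) (fun j => B.Y B.o j))
    (fun i => Sum.elim (fun _ => B.Y i B.o) (fun j => B.Y i j))
  o := Sum.inl A.o

theorem box_mono {A A' B B' : Config} (h : Le A A') (h' : Le B B') :
    Le (box A B) (box A' B') := by
  obtain ⟨f, hf, hX, hY, ho⟩ := h
  obtain ⟨g, hg, hX', hY', ho'⟩ := h'
  refine ⟨Sum.map f (fun j => ⟨g j, fun h => j.2 (hg (h.trans ho'.symm))⟩), ?_, ?_, ?_, ?_⟩
  · exact Function.Injective.sumMap hf fun i j h => Subtype.ext (hg (congrArg Subtype.val h))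
  · rintro (a | a) (b | b) <;> simp [box, hX, hX', ho']
  · rintro (a | a) (b | b) <;> simp [box, hY, hY', ho']
  · simp [box, ho]

end Config

open Config

/-- The configuration of a centred permutation. -/
def CentredPerm.cfg (σ : CentredPerm) : Config :=
  ofFun (fun i : Fin (σ.length + 1) => i) σ.perm σ.origin

theorem contained_iff_le (π σ : CentredPerm) : π.Contained σ ↔ Le π.cfg σ.cfg := by
  constructor
  · rintro ⟨f, h, ho⟩
    exact ⟨f, f.injective, fun i j => f.lt_iff_lt.symm, h, ho⟩
  · rintro ⟨f, -, hX, hY, ho⟩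
    exact ⟨OrderEmbedding.ofStrictMono f fun i j h => (hX i j).1 h, hY, ho⟩

/-! ### Patterns read off by sorting coordinates -/

theorem strictMono_sort {α : Type*} [LinearOrder α] {n : ℕ} {x : Fin n → α}
    (hx : Function.Injective x) : StrictMono (x ∘ Tuple.sort x) :=
  (Tuple.monotone_sort x).strictMono_of_injective (hx.comp (Tuple.sort x).injective)

theorem sort_symm_lt_iff {α : Type*} [LinearOrder α] {n : ℕ} {x : Fin n → α}
    (hx : Function.Injective x) (i j : Fin n) :
    (Tuple.sort x).symm i < (Tuple.sort x).symm j ↔ x i < x j := by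
  rw [← (strictMono_sort hx).lt_iff_lt]
  simp

theorem patternOf_iso {α β : Type*} [LinearOrder α] [LinearOrder β] {n : ℕ}
    {x : Fin (n + 1) → α} {y : Fin (n + 1) → β} (o : Fin (n + 1)) (hx : Function.Injective x)
    (hy : Function.Injective y) : Iso (patternOf x y o).cfg (ofFun x y o) := by
  refine ofFun_iso (Tuple.sort x) (fun i j => ?_) (fun i j => ?_) ?_
  · exact (strictMono_sort hx).lt_iff_lt.symm
  · exact sort_symm_lt_iff hy _ _
  · exact Equiv.apply_symm_apply _ _

theorem strictMono_fin_eq_id {n : ℕ} {f : Fin n → Fin n} (h : StrictMono f) : f = id := by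
  have h' := Finite.injective_iff_surjective.1 h.injective
  have : h.orderIsoOfSurjective f h' = OrderIso.refl _ := Subsingleton.elim _ _
  exact congrArg DFunLike.coe this

theorem perm_eq_of_lt_iff {n : ℕ} {p q : Equiv.Perm (Fin n)}
    (h : ∀ i j, p i < p j ↔ q i < q j) : p = q := by
  have : StrictMono (q ∘ p.symm) := fun i j hij => by
    have := h (p.symm i) (p.symm j)
    simp_all
  have := strictMono_fin_eq_id this
  ext i
  have := congrFun this (p i)
  simp_all

/-- A strictly increasing self-map of `Fin (m + 1)` is the identity. This turns isomorphism of
configurations back into equality of centred permutations. -/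
theorem eq_of_cfg_le {π σ : CentredPerm} (hl : π.length = σ.length) (h : Le π.cfg σ.cfg) :
    π = σ := by
  obtain ⟨m, p, o⟩ := π
  obtain ⟨n, q, o'⟩ := σ
  obtain rfl : m = n := hl
  obtain ⟨f, -, hX, hY, ho⟩ := h
  change Fin (m + 1) → Fin (m + 1) at f
  have hf : StrictMono f := fun i j h => (hX i j).1 h
  obtain rfl := strictMono_fin_eq_id hf
  obtain rfl : p = q := perm_eq_of_lt_iff hY
  obtain rfl : o = o' := ho
  rfl

theorem toLex_lt_of_eq {α β : Type*} [LinearOrder α] [LinearOrder β] (o : α) (a b : β) :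
    toLex (o, a) < toLex (o, b) ↔ a < b := by
  simp [Prod.Lex.toLex_lt_toLex]

theorem toLex_lt_same {α β : Type*} [LinearOrder α] [LinearOrder β] (o p : α) (a : β) :
    toLex (o, a) < toLex (p, a) ↔ o < p := by
  simp [Prod.Lex.toLex_lt_toLex]

theorem toLex_lt_of_ne {α β : Type*} [LinearOrder α] [LinearOrder β] {o p : α} (h : o ≠ p)
    (a b : β) : toLex (o, a) < toLex (p, b) ↔ o < p := by
  simp [Prod.Lex.toLex_lt_toLex, h]

theorem boxSum_iso (π σ : CentredPerm) : Iso (π.boxSum σ).cfg (box π.cfg σ.cfg) := by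
  refine (patternOf_iso _ ?_ ?_).trans ?_
  · have : Function.Injective (Sum.elim
      (fun a => (toLex (σ.origin, a) : Fin (σ.length + 1) ×ₗ Fin (π.length + 1)))
      (fun b => toLex (σ.origin.succAbove b, 0))) := by
      rintro (a | a) (b | b) <;> simp [Fin.succAbove_ne, (Fin.succAbove_ne _ _).symm]
    exact this.comp (boxIndex _ _).injective
  · have : Function.Injective (Sum.elim
      (fun a => (toLex (σ.perm σ.origin, π.perm a) : Fin (σ.length + 1) ×ₗ Fin (π.length + 1)))
      (fun b => toLex (σ.perm (σ.origin.succAbove b), 0))) := by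
      rintro (a | a) (b | b) <;> simp [Fin.succAbove_ne, (Fin.succAbove_ne _ _).symm]
    exact this.comp (boxIndex _ _).injective
  · refine (ofFun_iso (boxIndex π.length σ.length) (fun _ _ => Iff.rfl) (fun _ _ => Iff.rfl)
      (Equiv.apply_symm_apply _ _)).trans
      ⟨Equiv.sumCongr (Equiv.refl _) (finSuccAboveEquiv σ.origin), ?_, ?_, rfl⟩
    · rintro (i | i) (j | j)
      · exact toLex_lt_of_eq _ _ _
      · exact toLex_lt_of_ne (Fin.succAbove_ne _ _).symm _ _
      · exact toLex_lt_of_ne (Fin.succAbove_ne _ _) _ _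
      · exact toLex_lt_same _ _ _
    · rintro (i | i) (j | j)
      · exact toLex_lt_of_eq _ _ _
      · exact toLex_lt_of_ne (σ.perm.injective.ne (Fin.succAbove_ne _ _).symm) _ _
      · exact toLex_lt_of_ne (σ.perm.injective.ne (Fin.succAbove_ne _ _)) _ _
      · exact toLex_lt_same _ _ _

/-! ### Coordinates of pin sequences -/

/-- The behaviour of one coordinate of a pin sequence: the `j`-th term has absolute value `2 * j`,
except that at the flagged places it is the previous term moved one unit towards `0`. -/
structure IsZigzag (z : ℕ → ℤ) (F : ℕ → Bool) : Prop where
  zero : z 0 = 0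
  flag_zero : F 0 = false
  big : ∀ j, F j = false → |z j| = 2 * j
  flip : ∀ j, F (j + 1) = true → z (j + 1) = z j - (z j).sign ∧ F j = false ∧ 1 ≤ j

namespace IsZigzag

variable {z z' : ℕ → ℤ} {F F' : ℕ → Bool}

theorem flip_cases (h : IsZigzag z F) {j : ℕ} (hj : F (j + 1) = true) :
    (0 < z j ∧ z j = 2 * j ∧ z (j + 1) = 2 * j - 1 ∧ 1 ≤ j) ∨
      (z j < 0 ∧ z j = -(2 * j) ∧ z (j + 1) = -(2 * j - 1) ∧ 1 ≤ j) := by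
  obtain ⟨h1, h2, h3⟩ := h.flip j hj
  have h4 := h.big j h2
  rcases lt_trichotomy (z j) 0 with h5 | h5 | h5
  · rw [Int.sign_eq_neg_one_of_neg h5] at h1
    rw [abs_of_neg h5] at h4
    omega
  · rw [h5] at h4; simp at h4; omega
  · rw [Int.sign_eq_one_of_pos h5] at h1
    rw [abs_of_pos h5] at h4
    omega

/-- At a flagged place the absolute value is one less than the previous `2 * (j - 1)`, which is
where the 3 comes from. -/
theorem abs_bounds (h : IsZigzag z F) (j : ℕ) : |z j| ≤ 2 * j ∧ 2 * (j : ℤ) - 3 ≤ |z j| ∧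
    (1 ≤ j → 1 ≤ |z j|) := by
  cases hF : F j
  · have := h.big j hF; omega
  · cases j with
    | zero => simp [h.flag_zero] at hF
    | succ j =>
      rcases h.flip_cases hF with ⟨-, -, h1, h2⟩ | ⟨-, -, h1, h2⟩ <;> rw [h1]
      · rw [abs_of_pos (by omega)]; push_cast; omega
      · rw [abs_of_neg (by omega)]; push_cast; omega

/-- The later term exceeds every earlier one in absolute value, so its sign decides. The one
exception is a flagged `j = i + 1`, where the step back towards `0` reverses the comparison. A
flagged term still beats terms two places earlier, since `2 * j - 3 > 2 * (j - 2)`. -/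
theorem lt_iff (h : IsZigzag z F) {i j : ℕ} (hij : i < j) :
    z i < z j ↔ (0 < z j ↔ ¬(j = i + 1 ∧ F j = true)) := by
  by_cases hF : j = i + 1 ∧ F j = true
  · obtain ⟨rfl, hF⟩ := hF
    rcases h.flip_cases hF with ⟨h0, h1, h2, h3⟩ | ⟨h0, h1, h2, h3⟩ <;> simp [hF] <;> omega
  · have hi := h.abs_bounds i
    have hj := h.abs_bounds j
    have : |z i| < |z j| := by
      by_cases hj' : F j = true
      · have : i + 2 ≤ j := by
          simp only [hj', and_true] at hF
          omega
        omega
      · have := h.big j (by simpa using hj')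
        omega
    simp only [hF, not_false_eq_true, iff_true]
    constructor
    · intro h'
      by_contra h0
      rw [abs_of_nonpos (a := z j) (by omega)] at this
      have := neg_abs_le (z i)
      omega
    · intro h'
      rw [abs_of_pos h'] at this
      have := le_abs_self (z i)
      omega

theorem ne_of_lt (h : IsZigzag z F) {i j : ℕ} (hij : i < j) : z i ≠ z j := by
  intro he
  have hi := h.abs_bounds i
  have hj := h.abs_bounds j
  by_cases hF : F j = true
  · by_cases hj' : j = i + 1
    · subst hj'
      rcases h.flip_cases hF with h' | h' <;> omega
    · rw [he] at hi
      omega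
  · have := h.big j (by simpa using hF)
    rw [he] at hi
    omega

theorem injective (h : IsZigzag z F) : Function.Injective z := by
  intro i j hij
  by_contra hne
  rcases lt_or_gt_of_ne hne with hlt | hlt
  · exact h.ne_of_lt hlt hij
  · exact h.ne_of_lt hlt hij.symm

/-- By `lt_iff`, the signs and the flagged adjacent pairs determine the order pattern of a
subsequence. This serves both to shift a pin sequence and to encode its subpatterns. -/
theorem lt_iff_lt (h : IsZigzag z F) (h' : IsZigzag z' F') {ι : Type*} [LinearOrder ι]
    {f f' : ι → ℕ} (hf : StrictMono f) (hf' : StrictMono f')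
    (hs : ∀ t, 0 < z (f t) ↔ 0 < z' (f' t))
    (hF : ∀ s t, s < t → ((f t = f s + 1 ∧ F (f t) = true) ↔
      (f' t = f' s + 1 ∧ F' (f' t) = true))) (s t : ι) :
    z (f s) < z (f t) ↔ z' (f' s) < z' (f' t) := by
  have key : ∀ s t, s < t → (z (f s) < z (f t) ↔ z' (f' s) < z' (f' t)) := fun s t hst => by
    rw [h.lt_iff (hf hst), h'.lt_iff (hf' hst), hs, hF s t hst]
  rcases lt_trichotomy s t with hst | rfl | hst
  · exact key s t hst
  · simp
  · rw [← not_iff_not, not_lt, not_lt, le_iff_lt_or_eq, le_iff_lt_or_eq, key t s hst]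
    simp [h.ne_of_lt (hf hst), h'.ne_of_lt (hf' hst)]

end IsZigzag

namespace PinSequence

/-- The points of a pin sequence. -/
def point (w : PinSequence) (j : ℕ) : ℤ × ℤ := pinPoint w.first w.letter j

/-- The places with a vertical letter. -/
def flipX (w : PinSequence) : ℕ → Bool
  | k + 2 => (w.letter k).vertical
  | _ => false

/-- The places with a horizontal letter. -/
def flipY (w : PinSequence) : ℕ → Bool
  | k + 2 => !(w.letter k).vertical
  | _ => false

theorem point_one (w : PinSequence) : w.point 1 = w.first.firstPoint := rfl

theorem point_succ (w : PinSequence) (k : ℕ) :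
    (∃ ε : ℤ, (ε = 1 ∨ ε = -1) ∧ (0 < ε ↔ w.letter k = .u) ∧ (w.letter k).vertical = true ∧
      w.point (k + 2) =
      ((w.point (k + 1)).1 - (w.point (k + 1)).1.sign, ε * (2 * k + 4))) ∨
    (∃ ε : ℤ, (ε = 1 ∨ ε = -1) ∧ (0 < ε ↔ w.letter k = .r) ∧ (w.letter k).vertical = false ∧
      w.point (k + 2) =
      (ε * (2 * k + 4), (w.point (k + 1)).2 - (w.point (k + 1)).2.sign)) := by
  unfold point
  rw [pinPoint]
  cases h : w.letter k
  · exact Or.inl ⟨1, by simp [Dir.vertical]⟩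
  · exact Or.inl ⟨-1, by simp [Dir.vertical]⟩
  · exact Or.inr ⟨-1, by simp [Dir.vertical]⟩
  · exact Or.inr ⟨1, by simp [Dir.vertical]⟩

theorem abs_eps {ε : ℤ} (h : ε = 1 ∨ ε = -1) (k : ℕ) :
    |ε * (2 * k + 4)| = 2 * ((k + 2 : ℕ) : ℤ) := by
  rw [abs_mul, abs_of_nonneg (show (0 : ℤ) ≤ 2 * k + 4 by positivity)]
  rcases h with rfl | rfl <;> simp <;> ring

theorem zigzagX (w : PinSequence) : IsZigzag (fun j => (w.point j).1) w.flipX where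
  zero := rfl
  flag_zero := rfl
  big j hj := by
    match j with
    | 0 => rfl
    | 1 => rw [point_one]; cases w.first <;> rfl
    | k + 2 =>
      rcases w.point_succ k with ⟨ε, h1, h2, h3, h4⟩ | ⟨ε, h1, h2, h3, h4⟩
      · simp [flipX, h3] at hj
      · rw [h4]; exact abs_eps h1 k
  flip j hj := by
    match j with
    | 0 => simp [flipX] at hj
    | k + 1 =>
      rcases w.point_succ k with ⟨ε, h1, h2, h3, h4⟩ | ⟨ε, h1, h2, h3, h4⟩
      · refine ⟨by simp only [h4], ?_, by omega⟩
        cases k with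
        | zero => rfl
        | succ k =>
          have := w.alternates k
          simpa [flipX, h3] using this
      · simp [flipX, h3] at hj

theorem zigzagY (w : PinSequence) : IsZigzag (fun j => (w.point j).2) w.flipY where
  zero := rfl
  flag_zero := rfl
  big j hj := by
    match j with
    | 0 => rfl
    | 1 => rw [point_one]; cases w.first <;> rfl
    | k + 2 =>
      rcases w.point_succ k with ⟨ε, h1, h2, h3, h4⟩ | ⟨ε, h1, h2, h3, h4⟩
      · rw [h4]; exact abs_eps h1 k
      · simp [flipY, h3] at hj
  flip j hj := by
    match j with
    | 0 => simp [flipY] at hj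
    | k + 1 =>
      rcases w.point_succ k with ⟨ε, h1, h2, h3, h4⟩ | ⟨ε, h1, h2, h3, h4⟩
      · simp [flipY, h3] at hj
      · refine ⟨by simp only [h4], ?_, by omega⟩
        cases k with
        | zero => rfl
        | succ k =>
          have := w.alternates k
          simpa [flipY, h3] using this

/-! ### Shifts, box sums and factors as sets of points -/

/-- The pin sequence that continues from place `i + 1` on. -/
def shift (w : PinSequence) (i : ℕ) : PinSequence where
  first := quadrantOf (w.point (i + 1))
  letter k := w.letter (i + k)
  alternates k := w.alternates (i + k)

theorem pos_flip {z z' : ℕ → ℤ} {F F' : ℕ → Bool} (h : IsZigzag z F) (h' : IsZigzag z' F')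
    {j j' : ℕ} (hj : F (j + 1) = true) (hj' : F' (j' + 1) = true) (hp : 0 < z j ↔ 0 < z' j') :
    0 < z (j + 1) ↔ 0 < z' (j' + 1) := by
  rcases h.flip_cases hj with h1 | h1 <;> rcases h'.flip_cases hj' with h2 | h2 <;> omega

/-- Redrawing from place `i + 1` keeps every quadrant: a letter fixes the sign of one coordinate,
and the other coordinate inherits its sign from the previous point. -/
theorem shift_pos (w : PinSequence) (i k : ℕ) :
    (0 < ((w.shift i).point (k + 1)).1 ↔ 0 < (w.point (i + k + 1)).1) ∧
    (0 < ((w.shift i).point (k + 1)).2 ↔ 0 < (w.point (i + k + 1)).2) := by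
  induction k with
  | zero =>
    rw [point_one]
    simp only [shift, quadrantOf, add_zero]
    split_ifs <;> simp [Quadrant.firstPoint, *]
  | succ k ih =>
    have e : i + (k + 1) + 1 = (i + k) + 2 := by omega
    rw [e]
    have hl : (w.shift i).letter k = w.letter (i + k) := rfl
    rcases (w.shift i).point_succ k with ⟨ε, h1, h2, h3, h4⟩ | ⟨ε, h1, h2, h3, h4⟩ <;>
    rcases w.point_succ (i + k) with ⟨δ, g1, g2, g3, g4⟩ | ⟨δ, g1, g2, g3, g4⟩ <;>
    rw [hl] at h2 h3 <;> try exact absurd (h3.symm.trans g3) (by decide)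
    · refine ⟨pos_flip (w.shift i).zigzagX w.zigzagX h3 g3 ih.1, ?_⟩
      rw [h4, g4, mul_pos_iff_of_pos_right (by positivity),
        mul_pos_iff_of_pos_right (by positivity), h2, g2]
    · refine ⟨?_, pos_flip (w.shift i).zigzagY w.zigzagY (by simp [flipY, hl, h3])
        (by simp [flipY, g3]) ih.2⟩
      rw [h4, g4, mul_pos_iff_of_pos_right (by positivity),
        mul_pos_iff_of_pos_right (by positivity), h2, g2]

/-- The configuration formed by the origin and the points of `w` with indices in `S`. -/
def pts (w : PinSequence) (S : Set ℕ) : Config :=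
  ofFun (fun j : {j : ℕ // j = 0 ∨ j ∈ S} => (w.point j).1) (fun j => (w.point j).2)
    ⟨0, Or.inl rfl⟩

theorem pts_mono (w : PinSequence) {S T : Set ℕ} (h : S ⊆ T) : Le (w.pts S) (w.pts T) :=
  ⟨fun j => ⟨j.1, j.2.imp id fun hj => h hj⟩, fun _ _ hij =>
      Subtype.ext (congrArg (Subtype.val : {j : ℕ // j = 0 ∨ j ∈ T} → ℕ) hij),
    fun _ _ => Iff.rfl, fun _ _ => Iff.rfl, rfl⟩

/-- The gap excludes the adjacent case of `IsZigzag.lt_iff`, so a point of `T` compares with each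
point of `S` exactly as with the origin: the points of `S` inflate the origin. -/
theorem box_pts_iso (w : PinSequence) {S T : Set ℕ} (h : ∀ i ∈ S, ∀ j ∈ T, j ≠ 0 → i + 1 < j) :
    Iso (box (w.pts S) (w.pts T)) (w.pts (S ∪ T)) := by
  let f : (box (w.pts S) (w.pts T)).carrier → {j : ℕ // j = 0 ∨ j ∈ S ∪ T} :=
    Sum.elim (fun a => ⟨a.1, a.2.imp id Or.inl⟩) (fun j => ⟨j.1.1, j.1.2.imp id Or.inr⟩)
  have hne : ∀ j : {j : (w.pts T).carrier // j ≠ (w.pts T).o}, j.1.1 ≠ 0 :=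
    fun j hj => j.2 (Subtype.ext hj)
  have hT : ∀ j : {j : (w.pts T).carrier // j ≠ (w.pts T).o}, j.1.1 ∈ T :=
    fun j => j.1.2.resolve_left (hne j)
  have hlt : ∀ (a : (w.pts S).carrier) (j : {j : (w.pts T).carrier // j ≠ (w.pts T).o}),
      a.1 < j.1.1 ∧ (a.1 ≠ 0 → a.1 + 1 < j.1.1) := by
    intro a j
    have := hne j
    rcases a.2 with ha | ha
    · omega
    · have := h _ ha _ (hT j) (hne j)
      omega
  have hf : Function.Bijective f := by
    constructor
    · rintro (a | a) (b | b) hab <;> have hab := congrArg Subtype.val hab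
      · exact congrArg Sum.inl (Subtype.ext hab)
      · exact absurd hab (hlt a b).1.ne
      · exact absurd hab.symm (hlt b a).1.ne
      · exact congrArg Sum.inr (Subtype.ext (Subtype.ext hab))
    · rintro ⟨j, hj⟩
      by_cases hS : j = 0 ∨ j ∈ S
      · exact ⟨Sum.inl ⟨j, hS⟩, rfl⟩
      · push Not at hS
        refine ⟨Sum.inr ⟨⟨j, Or.inr ?_⟩, fun h => hS.1 (congrArg Subtype.val h)⟩, rfl⟩
        exact (hj.resolve_left hS.1).resolve_left hS.2
  have key : ∀ {z : ℕ → ℤ} {F : ℕ → Bool}, IsZigzag z F → (F 1 = false) →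
      ∀ (a : (w.pts S).carrier) (j : {j : (w.pts T).carrier // j ≠ (w.pts T).o}),
      (z 0 < z j.1.1 ↔ z a.1 < z j.1.1) ∧ (z j.1.1 < z 0 ↔ z j.1.1 < z a.1) := by
    intro z F hz hF a j
    have hl := hlt a j
    have h0 : 0 < j.1.1 := by omega
    have e : (z 0 < z j.1.1 ↔ z a.1 < z j.1.1) := by
      rcases eq_or_ne a.1 0 with ha | ha
      · rw [ha]
      · have h1 : ¬ (j.1.1 = a.1 + 1 ∧ F j.1.1 = true) := by
          have := hl.2 ha
          omega
        have h2 : ¬ (j.1.1 = 0 + 1 ∧ F j.1.1 = true) := by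
          have := hl.2 ha
          omega
        rw [hz.lt_iff h0, hz.lt_iff hl.1]
        simp only [h1, h2]
    refine ⟨e, ?_⟩
    have h1 := hz.ne_of_lt h0
    have h2 := hz.ne_of_lt hl.1
    omega
  refine ⟨Equiv.ofBijective f hf, ?_, ?_, rfl⟩
  · rintro (a | a) (b | b)
    · exact Iff.rfl
    · exact (key w.zigzagX rfl a b).1
    · exact (key w.zigzagX rfl b a).2
    · exact Iff.rfl
  · rintro (a | a) (b | b)
    · exact Iff.rfl
    · exact (key w.zigzagY rfl a b).1
    · exact (key w.zigzagY rfl b a).2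
    · exact Iff.rfl

theorem shift_pts_iso (w : PinSequence) (i m : ℕ) :
    Iso ((w.shift i).pts (Set.Icc 1 (m + 1))) (w.pts (Set.Icc (i + 1) (i + m + 1))) := by
  let g : ℕ → ℕ := fun j => if j = 0 then 0 else i + j
  have hg : StrictMono g := by
    intro a b hab
    simp only [g]
    split_ifs <;> omega
  let f : {j : ℕ // j = 0 ∨ j ∈ Set.Icc 1 (m + 1)} →
      {j : ℕ // j = 0 ∨ j ∈ Set.Icc (i + 1) (i + m + 1)} := fun j => ⟨g j.1, by
    rcases j with ⟨j, hj⟩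
    simp only [g, Set.mem_Icc] at hj ⊢
    split_ifs <;> omega⟩
  have hf : Function.Bijective f := by
    constructor
    · intro a b hab
      exact Subtype.ext (hg.injective (congrArg Subtype.val hab))
    · rintro ⟨j, hj⟩
      rcases eq_or_ne j 0 with rfl | hj0
      · exact ⟨⟨0, Or.inl rfl⟩, rfl⟩
      · have hj := hj.resolve_left hj0
        simp only [Set.mem_Icc] at hj
        refine ⟨⟨j - i, Or.inr (by simp only [Set.mem_Icc]; omega)⟩, Subtype.ext ?_⟩
        simp only [f, g]
        split_ifs <;> omega
  have hflip : ∀ j, 1 ≤ j → (w.shift i).flipX (j + 1) = w.flipX (i + j + 1) ∧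
      (w.shift i).flipY (j + 1) = w.flipY (i + j + 1) := by
    intro j hj
    obtain ⟨k, rfl⟩ := Nat.exists_eq_add_of_le' hj
    exact ⟨rfl, rfl⟩
  have key : ∀ {z z' : ℕ → ℤ} {F F' : ℕ → Bool}, IsZigzag z F → IsZigzag z' F' → F 1 = false →
      F' 1 = false → (∀ k, 0 < z (k + 1) ↔ 0 < z' (i + k + 1)) →
      (∀ j, 1 ≤ j → F (j + 1) = F' (i + j + 1)) → ∀ a b, z a < z b ↔ z' (g a) < z' (g b) := by
    intro z z' F F' hz hz' hF hF' hp hfl a b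
    refine hz.lt_iff_lt hz' (f := id) (f' := g) strictMono_id hg (fun t => ?_)
      (fun s t hst => ?_) a b
    · cases t with
      | zero => simp [g, hz.zero, hz'.zero]
      | succ k => simpa [g, add_assoc] using hp k
    · simp only [id, g]
      rcases eq_or_ne s 0 with rfl | hs
      -- A point adjacent to the origin has index 1, where no flag is set.
      · simp only [show t ≠ 0 by omega, if_true, if_false]
        constructor
        · rintro ⟨rfl, h⟩
          simp [hF] at h
        · rintro ⟨h1, h⟩
          rw [h1] at h
          simp [hF'] at h
      · simp only [show t ≠ 0 by omega, hs, if_false]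
        constructor
        · rintro ⟨rfl, h⟩
          exact ⟨by omega, by rw [← add_assoc, ← hfl s (by omega)]; exact h⟩
        · rintro ⟨h1, h⟩
          obtain rfl : t = s + 1 := by omega
          exact ⟨rfl, by rw [hfl s (by omega)]; exact h⟩
  refine ofFun_iso (Equiv.ofBijective f hf) (fun a b => ?_) (fun a b => ?_) rfl
  · exact key (w.shift i).zigzagX w.zigzagX rfl rfl (fun k => (w.shift_pos i k).1)
      (fun j hj => (hflip j hj).1) a b
  · exact key (w.shift i).zigzagY w.zigzagY rfl rfl (fun k => (w.shift_pos i k).2)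
      (fun j hj => (hflip j hj).2) a b

theorem pinPoint_congr (q : Quadrant) {s t : ℕ → Dir} (j : ℕ) (h : ∀ k, k + 2 ≤ j → s k = t k) :
    pinPoint q s j = pinPoint q t j := by
  induction j with
  | zero => rfl
  | succ j ih =>
    cases j with
    | zero => rfl
    | succ k =>
      rw [pinPoint, pinPoint, ih fun l hl => h l (by omega), h k le_rfl]

theorem initialWord_iso (w : PinSequence) (m : ℕ) :
    Iso (w.initialWord m).pinPerm.cfg (w.pts (Set.Icc 1 (m + 1))) := by
  have hlen : (w.initialWord m).letters.length = m := by simp [initialWord]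
  have hp : ∀ i : Fin ((w.initialWord m).letters.length + 1 + 1),
      pinPoint (w.initialWord m).first (fun k => (w.initialWord m).letters.getD k Dir.u) i =
        w.point i := by
    intro i
    refine pinPoint_congr _ _ fun k hk => ?_
    have hk' : k < m := by omega
    simp [initialWord, hk']
  unfold PinWord.pinPerm
  simp only [hp]
  refine (patternOf_iso _ (w.zigzagX.injective.comp Fin.val_injective)
    (w.zigzagY.injective.comp Fin.val_injective)).trans ?_
  let f : Fin ((w.initialWord m).letters.length + 1 + 1) →
      {j : ℕ // j = 0 ∨ j ∈ Set.Icc 1 (m + 1)} :=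
    fun i => ⟨i, by simp only [Set.mem_Icc]; omega⟩
  have hf : Function.Bijective f := by
    constructor
    · intro a b hab
      exact Fin.ext (congrArg Subtype.val hab)
    · rintro ⟨j, hj⟩
      simp only [Set.mem_Icc] at hj
      exact ⟨⟨j, by omega⟩, rfl⟩
  exact ofFun_iso (Equiv.ofBijective f hf) (fun _ _ => Iff.rfl) (fun _ _ => Iff.rfl) rfl

/-- The pin factor is, by definition, an initial word of the shifted sequence. -/
theorem factor_iso (w : PinSequence) (i m : ℕ) :
    Iso (w.factor i m).pinPerm.cfg (w.pts (Set.Icc (i + 1) (i + m + 1))) :=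
  ((w.shift i).initialWord_iso m).trans (w.shift_pts_iso i m)

end PinSequence

/-! ### The classes in terms of embeddings -/

/-- The centred permutation of length `0`. -/
def CentredPerm.trivial : CentredPerm := ⟨0, Equiv.refl _, 0⟩

theorem trivial_le (σ : CentredPerm) : Le CentredPerm.trivial.cfg σ.cfg := by
  refine ⟨fun _ => σ.origin, fun i j _ => Subsingleton.elim (α := Fin 1) i j, fun i j => ?_,
    fun i j => ?_, rfl⟩ <;>
  · obtain rfl := Subsingleton.elim (α := Fin 1) i j
    exact ⟨fun h => absurd h (lt_irrefl _), fun h => absurd h (lt_irrefl _)⟩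

theorem boxClosure_closed (S : Set CentredPerm) : IsBoxClosed (boxClosure S) :=
  fun π hπ σ hσ C hC => hC.2.1 π (hπ C hC) σ (hσ C hC)

theorem subset_boxClosure (S : Set CentredPerm) : S ⊆ boxClosure S :=
  fun _ hσ _ hC => hC.2.2 hσ

theorem boxClosure_down {S : Set CentredPerm} {π σ : CentredPerm} (h : Le π.cfg σ.cfg)
    (hσ : σ ∈ boxClosure S) : π ∈ boxClosure S :=
  fun C hC => hC.1.2 π σ ((contained_iff_le π σ).2 h) (hσ C hC)

theorem trivial_mem_boxClosure (S : Set CentredPerm) : CentredPerm.trivial ∈ boxClosure S := by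
  intro C hC
  obtain ⟨σ, hσ⟩ := hC.1.1
  exact hC.1.2 _ σ ((contained_iff_le _ σ).2 (trivial_le σ)) hσ

namespace PinSequence

/-- A finite pattern uses finitely many indices, which leaves room to place another pattern beyond
it. -/
theorem le_pts_bounded {w : PinSequence} {σ : CentredPerm} {S : Set ℕ}
    (h : Le σ.cfg (w.pts S)) : ∃ M, Le σ.cfg (w.pts (S ∩ Set.Iic M)) := by
  obtain ⟨f, hf, hX, hY, ho⟩ := h
  change Fin (σ.length + 1) → {j : ℕ // j = 0 ∨ j ∈ S} at f
  obtain ⟨M, hM⟩ := (Set.finite_range fun i => (f i).1).bddAbove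
  refine ⟨M, fun i => ⟨(f i).1, (f i).2.imp id fun h => ⟨h, hM ⟨i, rfl⟩⟩⟩, fun i j hij => hf ?_,
    hX, hY, Subtype.ext ?_⟩
  · exact Subtype.ext
      (congrArg (Subtype.val : {j : ℕ // j = 0 ∨ j ∈ S ∩ Set.Iic M} → ℕ) hij)
  · exact congrArg (Subtype.val : {j : ℕ // j = 0 ∨ j ∈ S} → ℕ) ho

theorem mem_centredPinClass_iff (w : PinSequence) (σ : CentredPerm) :
    σ ∈ w.centredPinClass ↔ Le σ.cfg (w.pts Set.univ) := by
  constructor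
  · rintro ⟨m, hm⟩
    exact (((contained_iff_le _ _).1 hm).trans (w.initialWord_iso m).le).trans
      (w.pts_mono (Set.subset_univ _))
  · intro h
    obtain ⟨M, hM⟩ := le_pts_bounded h
    refine ⟨M, (contained_iff_le _ _).2 (?_ : Le _ _)⟩
    refine Le.trans ?_ (w.initialWord_iso M).symm.le
    obtain ⟨f, hf, hX, hY, ho⟩ := hM
    refine ⟨fun i => ⟨(f i).1, ?_⟩, fun i j hij => hf ?_, hX, hY, Subtype.ext ?_⟩
    · have := (f i).2
      simp only [Set.univ_inter, Set.mem_Iic, Set.mem_Icc] at this ⊢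
      omega
    · exact Subtype.ext
        (congrArg (Subtype.val : {j : ℕ // j = 0 ∨ j ∈ Set.Icc 1 (M + 1)} → ℕ) hij)
    · exact congrArg (Subtype.val : {j : ℕ // j = 0 ∨ j ∈ Set.univ ∩ Set.Iic M} → ℕ) ho

/-- The permutations that embed in every tail form a `⊞`-closed class containing the generators,
hence containing the closure. Asking for every tail, not just for the whole sequence, is what makes
the class `⊞`-closed. -/
theorem le_pts_of_mem_boxInterior {w : PinSequence} {σ : CentredPerm} (h : σ ∈ w.boxInterior)
    (N : ℕ) : Le σ.cfg (w.pts (Set.Ici N)) := by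
  suffices hs : σ ∈ {σ : CentredPerm | ∀ N, Le σ.cfg (w.pts (Set.Ici N))} from hs N
  have hgen : ∀ v, w.IsRecurrentFactor v → ∀ N, Le v.pinPerm.cfg (w.pts (Set.Ici N)) := by
    intro v hv N
    obtain ⟨i, hi, m, rfl⟩ := hv N
    refine (w.factor_iso i m).le.trans (w.pts_mono fun j hj => ?_)
    simp only [Set.mem_Icc, Set.mem_Ici] at hj ⊢
    omega
  refine h _ ⟨⟨⟨CentredPerm.trivial, fun N => ?_⟩, fun π σ hπ hσ N => ?_⟩,
    fun π hπ σ hσ N => ?_, ?_⟩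
  · exact (trivial_le _).trans ((w.factor_iso N 0).le.trans (w.pts_mono fun j hj => by
      simp only [Set.mem_Icc, Set.mem_Ici] at hj ⊢
      omega))
  · exact ((contained_iff_le _ _).1 hπ).trans (hσ N)
  · obtain ⟨M, hM⟩ := le_pts_bounded (hπ N)
    -- Starting at `M + 2` skips the index `M + 1`, the gap that `box_pts_iso` needs.
    refine (boxSum_iso π σ).le.trans ((box_mono hM (hσ (max N (M + 2)))).trans
      ((w.box_pts_iso fun i hi j hj _ => ?_).le.trans (w.pts_mono ?_)))
    · simp only [Set.mem_inter_iff, Set.mem_Iic, Set.mem_Ici, max_le_iff] at hi hj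
      omega
    · intro j hj
      simp only [Set.mem_union, Set.mem_inter_iff, Set.mem_Iic, Set.mem_Ici, max_le_iff] at hj ⊢
      omega
  · rintro _ ⟨v, hv, rfl⟩
    exact hgen v hv

theorem boxInterior_subset (w : PinSequence) : w.boxInterior ⊆ w.centredPinClass := fun σ hσ =>
  (w.mem_centredPinClass_iff σ).2 ((le_pts_of_mem_boxInterior hσ 0).trans
    (w.pts_mono (Set.subset_univ _)))

instance : Finite Dir :=
  Set.finite_univ_iff.1 ((Set.toFinite {Dir.u, Dir.d, Dir.l, Dir.r}).subset
    (by rintro (_ | _) - <;> simp))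

instance : Finite Quadrant :=
  Set.finite_univ_iff.1 ((Set.toFinite {Quadrant.q1, Quadrant.q2, Quadrant.q3, Quadrant.q4}).subset
    (by rintro (_ | _) - <;> simp))

/-- There are finitely many pin words of length `m + 1`, and each non-recurrent one stops occurring.
-/
theorem eventually_recurrent (w : PinSequence) (m : ℕ) :
    ∃ N, ∀ i ≥ N, w.IsRecurrentFactor (w.factor i m) := by
  let code : ℕ → Quadrant × (Fin m → Dir) :=
    fun i => ((w.factor i m).first, fun t => w.letter (i + t))
  have hcode : ∀ i j, code i = code j → w.factor i m = w.factor j m := by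
    intro i j hij
    have h1 := congrArg Prod.fst hij
    have h2 := congrArg Prod.snd hij
    simp only [code, factor] at h1 h2
    simp only [factor, h1, h2]
  have : ∀ᶠ i in atTop, ∀ c, code i = c → w.IsRecurrentFactor (w.factor i m) := by
    rw [eventually_all]
    intro c
    by_cases hc : ∃ᶠ i in atTop, code i = c
    · refine Eventually.of_forall fun i hi N => ?_
      obtain ⟨j, hj, hjc⟩ := (frequently_atTop.1 hc) N
      exact ⟨j, hj, m, hcode _ _ (hjc.trans hi.symm)⟩
    · exact (not_frequently.1 hc).mono fun i hi h => absurd h hi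
  obtain ⟨N, hN⟩ := eventually_atTop.1 this
  exact ⟨N, fun i hi => hN i hi _ rfl⟩

/-- The blocks are the `m + 1` indices strictly between consecutive separators `(m + 2) * q + r`.
The missing separator makes each further block a new `⊞`-summand, and that block is a recurrent
factor. -/
theorem exists_block_bound (w : PinSequence) {m N : ℕ}
    (hN : ∀ i ≥ N, w.IsRecurrentFactor (w.factor i m)) (r Q : ℕ) :
    ∃ τ ∈ w.boxInterior, Le (w.pts {j | ∃ q, N ≤ q ∧ q < Q ∧ (m + 2) * q + r < j ∧
      j < (m + 2) * q + r + (m + 2)}) τ.cfg := by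
  induction Q with
  | zero =>
    have h0 : ∀ a : {j : ℕ // j = 0 ∨ j ∈ {j | ∃ q, N ≤ q ∧ q < 0 ∧ (m + 2) * q + r < j ∧
      j < (m + 2) * q + r + (m + 2)}}, a.1 = 0 := by
      rintro ⟨j, hj⟩
      simpa using hj
    refine ⟨_, trivial_mem_boxClosure _, fun _ => CentredPerm.trivial.origin, ?_, ?_, ?_, rfl⟩
    · exact fun a b _ => Subtype.ext ((h0 a).trans (h0 b).symm)
    · intro a b
      obtain rfl : a = b := Subtype.ext ((h0 a).trans (h0 b).symm)
      exact ⟨fun h => absurd h (lt_irrefl _), fun h => absurd h (lt_irrefl _)⟩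
    · intro a b
      obtain rfl : a = b := Subtype.ext ((h0 a).trans (h0 b).symm)
      exact ⟨fun h => absurd h (lt_irrefl _), fun h => absurd h (lt_irrefl _)⟩
  | succ Q ih =>
    obtain ⟨τ, hτ, hle⟩ := ih
    by_cases hQ : N ≤ Q
    · have hi : (m + 2) * Q + r ≥ N := by nlinarith
      refine ⟨τ.boxSum (w.factor ((m + 2) * Q + r) m).pinPerm,
        boxClosure_closed _ _ hτ _ (subset_boxClosure _ ⟨_, hN _ hi, rfl⟩), ?_⟩
      refine Le.trans ?_ (boxSum_iso _ _).symm.le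
      refine Le.trans ?_ (box_mono hle (w.factor_iso _ m).symm.le)
      refine Le.trans (w.pts_mono ?_) (w.box_pts_iso ?_).symm.le
      · rintro j ⟨q, h1, h2, h3, h4⟩
        rcases (Nat.lt_succ_iff_lt_or_eq.1 h2) with h2 | rfl
        · exact Or.inl ⟨q, h1, h2, h3, h4⟩
        · refine Or.inr ?_
          simp only [Set.mem_Icc]
          omega
      · rintro i ⟨q, h1, h2, h3, h4⟩ j hj -
        simp only [Set.mem_Icc] at hj
        have : (m + 2) * (q + 1) ≤ (m + 2) * Q := Nat.mul_le_mul_left _ h2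
        rw [mul_add] at this
        omega
    · refine ⟨τ, hτ, (w.pts_mono ?_).trans hle⟩
      rintro j ⟨q, h1, h2, h3, h4⟩
      omega

theorem mem_boxInterior_of_le (w : PinSequence) {m N : ℕ}
    (hN : ∀ i ≥ N, w.IsRecurrentFactor (w.factor i m)) {r : ℕ} (hr : r < m + 2)
    {σ : CentredPerm}
    (h : Le σ.cfg (w.pts {j | (m + 2) * (N + 1) < j ∧ j % (m + 2) ≠ r})) :
    σ ∈ w.boxInterior := by
  obtain ⟨M, hM⟩ := le_pts_bounded h
  obtain ⟨τ, hτ, hle⟩ := w.exists_block_bound hN r (M + 1)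
  refine boxClosure_down (hM.trans ((w.pts_mono ?_).trans hle)) hτ
  rintro j ⟨⟨h1, h2⟩, h3⟩
  simp only [Set.mem_Iic] at h3
  have h4 := Nat.div_add_mod (j - r) (m + 2)
  have h5 := Nat.mod_lt (j - r) (show m + 2 > 0 by omega)
  rw [mul_add] at h1
  have h6 : (j - r) / (m + 2) ≤ j - r := Nat.div_le_self _ _
  -- The number of the block containing `j`. It is at least `N` because `j > (m + 2) * (N + 1)` and
  -- `r < m + 2`; it is not a separator because `j % (m + 2) ≠ r`.
  refine ⟨(j - r) / (m + 2), ?_, by omega, ?_, by omega⟩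
  · rw [Nat.le_div_iff_mul_le (by omega), mul_comm]
    omega
  · by_contra hc
    apply h2
    have : j = r + (m + 2) * ((j - r) / (m + 2)) := by omega
    rw [this, Nat.add_mul_mod_self_left, Nat.mod_eq_of_lt hr]

end PinSequence

/-! ### Enumeration inequalities -/

theorem PinSequence.centredEnum_boxInterior_le (w : PinSequence) (n : ℕ) :
    centredEnum w.boxInterior n ≤ centredEnum w.centredPinClass n :=
  Set.ncard_le_ncard (fun _ h => ⟨w.boxInterior_subset h.1, h.2⟩) (finite_centred _ n)

theorem PinSequence.uncentredEnum_le (w : PinSequence) (n : ℕ) :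
    uncentredEnum w.pinClass n ≤ centredEnum w.centredPinClass n := by
  have : {σ | σ ∈ w.pinClass ∧ σ.length = n} =
      CentredPerm.underlying '' {σ | σ ∈ w.centredPinClass ∧ σ.length = n} := by
    ext τ
    constructor
    · rintro ⟨⟨σ, hσ, rfl⟩, h⟩
      exact ⟨σ, ⟨hσ, h⟩, rfl⟩
    · rintro ⟨σ, ⟨hσ, h⟩, rfl⟩
      exact ⟨⟨σ, hσ, rfl⟩, h⟩
  unfold uncentredEnum centredEnum
  rw [this]
  exact Set.ncard_image_le (finite_centred _ n)

/-! ### Forgetting the origin -/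

theorem CentredPerm.succAbove_underlying (σ : CentredPerm) (i : Fin σ.length) :
    (σ.perm σ.origin).succAbove (σ.underlying.perm i) = σ.perm (σ.origin.succAbove i) := by
  change (finSuccAboveEquiv (σ.perm σ.origin) ((finSuccAboveEquiv (σ.perm σ.origin)).symm
    ⟨σ.perm (σ.origin.succAbove i), _⟩)).1 = _
  rw [Equiv.apply_symm_apply]

theorem CentredPerm.eq_of_underlying {σ τ : CentredPerm} (h : σ.underlying = τ.underlying)
    (ho : (σ.origin : ℕ) = τ.origin) (hv : (σ.perm σ.origin : ℕ) = τ.perm τ.origin) :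
    σ = τ := by
  have hs := σ.succAbove_underlying
  have ht := τ.succAbove_underlying
  obtain ⟨n, p, o⟩ := σ
  obtain ⟨n', q, o'⟩ := τ
  obtain rfl : n = n' := congrArg Permutation.length h
  obtain rfl : o = o' := Fin.ext ho
  have hv : p o = q o := Fin.ext hv
  have : p = q := by
    ext1 i
    rcases eq_or_ne i o with rfl | hi
    · exact hv
    · obtain ⟨j, rfl⟩ := Fin.exists_succAbove_eq hi
      have h1 : (p o).succAbove _ = p (o.succAbove j) := hs j
      have h2 : (q o).succAbove _ = q (o.succAbove j) := ht j
      rw [← h1, ← h2, hv]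
      exact congrArg (fun e : Equiv.Perm (Fin n) => (q o).succAbove (e j))
        (eq_of_heq (Permutation.mk.inj h).2)
  rw [this]

theorem PinSequence.centredEnum_le_uncentred (w : PinSequence) (n : ℕ) :
    centredEnum w.centredPinClass n ≤ uncentredEnum w.pinClass n * ((n + 1) * (n + 1)) := by
  have key := Set.ncard_le_ncard_of_injOn (s := {σ | σ ∈ w.centredPinClass ∧ σ.length = n})
    (t := {σ | σ ∈ w.pinClass ∧ σ.length = n} ×ˢ
      ((Finset.range (n + 1) : Set ℕ) ×ˢ (Finset.range (n + 1) : Set ℕ)))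
    (fun σ => (σ.underlying, (σ.origin : ℕ), (σ.perm σ.origin : ℕ)))
    (fun σ hσ => ⟨⟨⟨σ, hσ.1, rfl⟩, hσ.2⟩,
      Finset.mem_coe.2 (Finset.mem_range.2 (hσ.2 ▸ Fin.is_lt _)),
      Finset.mem_coe.2 (Finset.mem_range.2 (hσ.2 ▸ Fin.is_lt _))⟩)
    (fun σ _ τ _ h => by
      simp only [Prod.mk.injEq] at h
      exact CentredPerm.eq_of_underlying h.1 h.2.1 h.2.2)
    ((finite_uncentred _ n).prod ((Finset.finite_toSet _).prod (Finset.finite_toSet _)))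
  simp only [Set.ncard_prod, Set.ncard_coe_finset, Finset.card_range] at key
  exact key

/-! ### An exponential upper bound -/

/-- The data that determine the pattern of the points with indices `a 0 < a 1 < ⋯`. -/
def PinSequence.code (w : PinSequence) {n : ℕ} (a : Fin (n + 1) → ℕ) (t : Fin (n + 1)) :
    Bool × Bool × Bool × Bool :=
  open Classical in
  (decide (0 < (w.point (a t)).1), decide (0 < (w.point (a t)).2),
    decide (∃ s, s < t ∧ a t = a s + 1 ∧ w.flipX (a t) = true),
    decide (∃ s, s < t ∧ a t = a s + 1 ∧ w.flipY (a t) = true))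

theorem PinSequence.exists_code {w : PinSequence} {σ : CentredPerm}
    (h : σ ∈ w.centredPinClass) : ∃ a : Fin (σ.length + 1) → ℕ, StrictMono a ∧
      Iso σ.cfg (ofFun (fun i => (w.point (a i)).1) (fun i => (w.point (a i)).2) 0) := by
  obtain ⟨f, hf, hX, hY, ho⟩ := (w.mem_centredPinClass_iff σ).1 h
  let g : Fin (σ.length + 1) → ℕ := fun i => (f i).1
  have hg : Function.Injective g := fun i j hij => hf (Subtype.ext hij)
  have ho : g σ.origin = 0 := congrArg (Subtype.val : {j : ℕ // j = 0 ∨ j ∈ Set.univ} → ℕ) ho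
  have ha := strictMono_sort hg
  refine ⟨g ∘ Tuple.sort g, ha, ofFun_iso (Tuple.sort g).symm ?_ ?_ ?_⟩
  · intro i j
    simp only [Function.comp, Equiv.apply_symm_apply]
    exact hX i j
  · intro i j
    simp only [Function.comp, Equiv.apply_symm_apply]
    exact hY i j
  · refine ha.injective (le_antisymm ?_ (ha.monotone (Fin.zero_le _)))
    simp [ho]

/-- The code only says that some earlier chosen index is adjacent. Since the indices increase, it
can only be that of the immediate predecessor, so the flagged pairs agree and `IsZigzag.lt_iff_lt`
applies. -/
theorem PinSequence.pos_lt_iff_of_code (w : PinSequence) {n : ℕ} {a b : Fin (n + 1) → ℕ}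
    (ha : StrictMono a) (hb : StrictMono b) (h : w.code a = w.code b) :
    Iso (ofFun (fun i => (w.point (a i)).1) (fun i => (w.point (a i)).2) 0)
      (ofFun (fun i => (w.point (b i)).1) (fun i => (w.point (b i)).2) 0) := by
  have hadj : ∀ {F : ℕ → Bool} {c d : Fin (n + 1) → ℕ}, StrictMono c → StrictMono d →
      ∀ {s t}, s < t →
      ((∃ s, s < t ∧ c t = c s + 1 ∧ F (c t) = true) →
        (∃ s, s < t ∧ d t = d s + 1 ∧ F (d t) = true)) →
      c t = c s + 1 ∧ F (c t) = true → d t = d s + 1 ∧ F (d t) = true := by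
    intro F c d hc hd s t hst himp hcs
    obtain ⟨s', hs', h1, h2⟩ := himp ⟨s, hst, hcs⟩
    have : s' = s := by
      rcases lt_trichotomy s' s with hlt | h | hlt
      · have := hd hlt
        have := hd hst
        omega
      · exact h
      · have := hc hlt
        have := hc hs'
        omega
    exact ⟨this ▸ h1, h2⟩
  have hc : ∀ t, _ := fun t => congrFun h t
  simp only [code, Prod.mk.injEq, decide_eq_decide] at hc
  refine ofFun_iso (Equiv.refl _) (fun i j => ?_) (fun i j => ?_) rfl
  · exact w.zigzagX.lt_iff_lt w.zigzagX ha hb (fun t => (hc t).1)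
      (fun s t hst => ⟨hadj ha hb hst (hc t).2.2.1.1, hadj hb ha hst (hc t).2.2.1.2⟩) i j
  · exact w.zigzagY.lt_iff_lt w.zigzagY ha hb (fun t => (hc t).2.1)
      (fun s t hst => ⟨hadj ha hb hst (hc t).2.2.2.1, hadj hb ha hst (hc t).2.2.2.2⟩) i j

/-- Four bits for each of the `n + 1` points determine the permutation. -/
theorem PinSequence.centredEnum_le_pow (w : PinSequence) (n : ℕ) :
    centredEnum w.centredPinClass n ≤ 16 ^ (n + 1) := by
  have hex : ∀ σ : CentredPerm, ∃ c : Fin (n + 1) → Bool × Bool × Bool × Bool,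
      σ ∈ w.centredPinClass → σ.length = n → ∃ a : Fin (n + 1) → ℕ, StrictMono a ∧
      Iso σ.cfg (ofFun (fun i => (w.point (a i)).1) (fun i => (w.point (a i)).2) 0) ∧
      c = w.code a := by
    intro σ
    by_cases h : σ ∈ w.centredPinClass ∧ σ.length = n
    · obtain ⟨h, rfl⟩ := h
      obtain ⟨a, ha, hi⟩ := PinSequence.exists_code h
      exact ⟨w.code a, fun _ _ => ⟨a, ha, hi, rfl⟩⟩
    · exact ⟨fun _ => default, fun h1 h2 => absurd ⟨h1, h2⟩ h⟩
  choose c hc using hex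
  have key := Set.ncard_le_ncard_of_injOn (s := {σ | σ ∈ w.centredPinClass ∧ σ.length = n})
    (t := Set.univ) c (fun _ _ => Set.mem_univ _) (fun σ hσ τ hτ h => by
      obtain ⟨a, ha, hi, hca⟩ := hc σ hσ.1 hσ.2
      obtain ⟨b, hb, hi', hcb⟩ := hc τ hτ.1 hτ.2
      rw [hca, hcb] at h
      exact eq_of_cfg_le (hσ.2.trans hτ.2.symm)
        ((hi.trans (w.pos_lt_iff_of_code ha hb h)).trans hi'.symm).le) Set.finite_univ
  rw [Set.ncard_univ] at key
  refine key.trans (le_of_eq ?_)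
  simp

/-! ### Cancellation in box sums -/

/-- Horizontal positions in a box sum. -/
def boxPosition {m n : ℕ} (p : Fin (n + 1)) : Fin (m + 1) ⊕ {j : Fin (n + 1) // j ≠ p} → ℕ :=
  Sum.elim (fun a => p + a) (fun j => if j.1 < p then j.1 else j.1 + m)

theorem boxPosition_injective {m n : ℕ} (p : Fin (n + 1)) :
    Function.Injective (boxPosition (m := m) p) := by
  rintro (a | ⟨a, ha⟩) (b | ⟨b, hb⟩) h <;>
    simp only [boxPosition, Sum.elim_inl, Sum.elim_inr, Fin.lt_def] at h
  · exact congrArg _ (Fin.ext (by omega))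
  · exfalso
    have := Fin.val_ne_of_ne hb
    split_ifs at h <;> omega
  · exfalso
    have := Fin.val_ne_of_ne ha
    split_ifs at h <;> omega
  · refine congrArg _ (Subtype.ext (Fin.ext ?_))
    have := Fin.val_ne_of_ne hb
    have := Fin.val_ne_of_ne ha
    split_ifs at h <;> simp only <;> omega

theorem strictMono_fin_nat_eq {N : ℕ} {g : Fin N → ℕ} (h : StrictMono g) (hb : ∀ i, g i < N)
    (i : Fin N) : g i = i := by
  have : StrictMono (fun i => (⟨g i, hb i⟩ : Fin N)) := fun a b hab => h hab
  exact congrArg Fin.val (congrFun (strictMono_fin_eq_id this) i)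

theorem boxPosition_eq {τ π σ : CentredPerm} (hl : τ.length = π.length + σ.length)
    {f : Fin (τ.length + 1) → Fin (π.length + 1) ⊕ {j : Fin (σ.length + 1) // j ≠ σ.origin}}
    (hX : ∀ i j, i < j ↔ (box π.cfg σ.cfg).X (f i) (f j)) (i : Fin (τ.length + 1)) :
    boxPosition σ.origin (f i) = i := by
  refine strictMono_fin_nat_eq (g := fun i => boxPosition σ.origin (f i))
    (fun i j hij => ?_) (fun i => ?_) i
  · have h := (hX i j).1 hij
    simp only
    generalize f i = u at h ⊢
    generalize f j = v at h ⊢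
    rcases u with a | ⟨a, ha⟩ <;> rcases v with b | ⟨b, hb⟩
    · have h : a < b := h
      simpa [boxPosition] using h
    · have h : σ.origin < b := h
      simp only [boxPosition, Sum.elim_inl, Sum.elim_inr]
      rw [if_neg h.asymm]
      omega
    · have h : a < σ.origin := h
      simp only [boxPosition, Sum.elim_inl, Sum.elim_inr, if_pos h]
      omega
    · have h : a < b := h
      simp only [boxPosition, Sum.elim_inr, Fin.lt_def] at h ⊢
      split_ifs <;> omega
  · rcases f i with a | a <;> simp only [boxPosition, Sum.elim_inl, Sum.elim_inr]
    · omega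
    · split_ifs <;> omega

/-- The origin of the sum sits at the sum of the two origin positions, so knowing one gives the
other. Then `boxPosition` identifies the two decompositions point by point, and the vertical
relations can be compared. Lengths alone do not suffice: a point in quadrant 1 and a point in
quadrant 3 commute under `⊞`. -/
theorem boxSum_cancel {π π' σ σ' : CentredPerm} (hm : π.length = π'.length)
    (hn : σ.length = σ'.length) (ho : (π.origin : ℕ) = π'.origin)
    (h : π.boxSum σ = π'.boxSum σ') : π = π' ∧ σ = σ' := by
  obtain ⟨f, hX, hY, hf⟩ := boxSum_iso π σ
  have hi : Iso (π.boxSum σ).cfg (box π'.cfg σ'.cfg) := h ▸ boxSum_iso π' σ'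
  obtain ⟨f', hX', hY', hf'⟩ := hi
  have hl : (π.boxSum σ).length = π.length + σ.length := rfl
  clear h
  generalize π.boxSum σ = τ at *
  obtain ⟨m, p, o⟩ := π
  obtain ⟨m', p', o'⟩ := π'
  obtain ⟨n, q, r⟩ := σ
  obtain ⟨n', q', r'⟩ := σ'
  obtain rfl : m = m' := hm
  obtain rfl : n = n' := hn
  obtain rfl : o = o' := Fin.ext ho
  have h1 := boxPosition_eq (π := ⟨m, p, o⟩) (σ := ⟨n, q, r⟩) (f := f) hl hX
  have h2 := boxPosition_eq (π := ⟨m, p', o⟩) (σ := ⟨n, q', r'⟩) (f := f') hl hX'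
  have h3 := h1 τ.origin
  have h4 := h2 τ.origin
  have hf : f τ.origin = Sum.inl o := hf
  have hf' : f' τ.origin = Sum.inl o := hf'
  rw [hf] at h3
  rw [hf'] at h4
  have h3 : (r : ℕ) + o = τ.origin := h3
  have h4 : (r' : ℕ) + o = τ.origin := h4
  obtain rfl : r = r' := Fin.ext (by omega)
  have hff : ∀ i, f i = f' i := fun i =>
    boxPosition_injective (m := m) r ((h1 i).trans (h2 i).symm)
  have hB : ∀ u v : Fin (m + 1) ⊕ {j : Fin (n + 1) // j ≠ r},
      (box (CentredPerm.cfg ⟨m, p, o⟩) (CentredPerm.cfg ⟨n, q, r⟩)).Y u v ↔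
      (box (CentredPerm.cfg ⟨m, p', o⟩) (CentredPerm.cfg ⟨n, q', r⟩)).Y u v := by
    intro u v
    obtain ⟨i, rfl⟩ := f.surjective u
    obtain ⟨j, rfl⟩ := f.surjective v
    rw [← hY i j, hY' i j, ← hff, ← hff]
  have hp : p = p' := perm_eq_of_lt_iff fun i j => hB (Sum.inl i) (Sum.inl j)
  have hq : q = q' := perm_eq_of_lt_iff fun i j => by
    by_cases hi : i = r <;> by_cases hj : j = r
    · subst hi; subst hj; simp
    · subst hi; exact hB (Sum.inl o) (Sum.inr ⟨j, hj⟩)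
    · subst hj; exact hB (Sum.inr ⟨i, hi⟩) (Sum.inl o)
    · exact hB (Sum.inr ⟨i, hi⟩) (Sum.inr ⟨j, hj⟩)
  rw [hp, hq]
  exact ⟨rfl, rfl⟩

/-- The factor `m + 1` counts the origin positions of the first summand, as required for
cancellation. -/
theorem centredEnum_mul_le {C : Set CentredPerm} (hC : IsBoxClosed C) (m n : ℕ) :
    centredEnum C m * centredEnum C n ≤ (m + 1) * centredEnum C (m + n) := by
  have key := Set.ncard_le_ncard_of_injOn
    (s := {σ | σ ∈ C ∧ σ.length = m} ×ˢ {σ | σ ∈ C ∧ σ.length = n})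
    (t := (Finset.range (m + 1) : Set ℕ) ×ˢ {σ | σ ∈ C ∧ σ.length = m + n})
    (fun x => ((x.1.origin : ℕ), x.1.boxSum x.2))
    (fun x hx => ⟨Finset.mem_coe.2 (Finset.mem_range.2 (hx.1.2 ▸ Fin.is_lt _)),
      hC _ hx.1.1 _ hx.2.1, by rw [← hx.1.2, ← hx.2.2]; rfl⟩)
    (fun x hx y hy h => by
      simp only [Prod.mk.injEq] at h
      exact Prod.ext_iff.2
        (boxSum_cancel (hx.1.2.trans hy.1.2.symm) (hx.2.2.trans hy.2.2.symm) h.1 h.2))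
    ((Finset.finite_toSet _).prod (finite_centred _ _))
  simp only [Set.ncard_prod, Set.ncard_coe_finset, Finset.card_range] at key
  exact key

theorem PinSequence.centredEnum_boxInterior_pos (w : PinSequence) (n : ℕ) :
    1 ≤ centredEnum w.boxInterior n := by
  have hex : ∃ σ ∈ w.boxInterior, σ.length = n := by
    induction n with
    | zero => exact ⟨_, trivial_mem_boxClosure _, rfl⟩
    | succ n ih =>
      obtain ⟨σ, hσ, hl⟩ := ih
      obtain ⟨N, hN⟩ := w.eventually_recurrent 0
      exact ⟨σ.boxSum (w.factor N 0).pinPerm, boxClosure_closed _ _ hσ _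
        (subset_boxClosure _ ⟨_, hN N le_rfl, rfl⟩), by rw [← hl]; rfl⟩
  obtain ⟨σ, h⟩ := hex
  exact (Set.ncard_pos (finite_centred _ n)).2 ⟨σ, h⟩

/-! ### Splitting off a set of points -/

/-- The centred permutation `τ` is the pattern of the points with positions in `U` of the
permutation `s` with origin `o`. -/
def IsSub (τ : CentredPerm) {n : ℕ} (s : Equiv.Perm (Fin (n + 1))) (o : Fin (n + 1))
    (U : Finset (Fin (n + 1))) : Prop :=
  ∃ g : Fin (τ.length + 1) → Fin (n + 1), StrictMono g ∧ Set.range g = U ∧ g τ.origin = o ∧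
    ∀ i j, τ.perm i < τ.perm j ↔ s (g i) < s (g j)

theorem exists_isSub {n l : ℕ} (s : Equiv.Perm (Fin (n + 1))) {o : Fin (n + 1)}
    {U : Finset (Fin (n + 1))} (ho : o ∈ U) (hU : U.card = l + 1) :
    ∃ τ : CentredPerm, τ.length = l ∧ IsSub τ s o U := by
  let x := U.orderEmbOfFin hU
  have hr : Set.range x = U := U.range_orderEmbOfFin hU
  obtain ⟨i, hi⟩ : o ∈ Set.range x := by rw [hr]; exact ho
  have hy : Function.Injective (s ∘ x) := s.injective.comp x.injective
  refine ⟨patternOf x (s ∘ x) i, rfl, x ∘ Tuple.sort x, strictMono_sort x.injective, ?_, ?_, ?_⟩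
  · exact ((Tuple.sort x).surjective.range_comp x).trans hr
  · exact (congrArg x (Equiv.apply_symm_apply _ _)).trans hi
  · exact fun a b => sort_symm_lt_iff hy _ _

theorem IsSub.le {τ : CentredPerm} {n : ℕ} {s : Equiv.Perm (Fin (n + 1))} {o : Fin (n + 1)}
    {U : Finset (Fin (n + 1))} (h : IsSub τ s o U) : Le τ.cfg (CentredPerm.cfg ⟨n, s, o⟩) := by
  obtain ⟨g, hg, -, ho, hY⟩ := h
  exact ⟨g, hg.injective, fun _ _ => hg.lt_iff_lt.symm, hY, ho⟩

theorem IsSub.unique {τ : CentredPerm} {n : ℕ} {s s' : Equiv.Perm (Fin (n + 1))}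
    {o o' : Fin (n + 1)} {U : Finset (Fin (n + 1))} (h : IsSub τ s o U) (h' : IsSub τ s' o' U)
    (hV : s '' U = s' '' U) : o = o' ∧ ∀ i ∈ U, s i = s' i := by
  obtain ⟨g, hg, hr, ho, hY⟩ := h
  obtain ⟨g', hg', hr', ho', hY'⟩ := h'
  obtain rfl : g = g' := (hg.range_inj hg').1 (hr.trans hr'.symm)
  refine ⟨ho.symm.trans ho', ?_⟩
  have hm : ∀ {t : Equiv.Perm (Fin (n + 1))}, (∀ i j, τ.perm i < τ.perm j ↔ t (g i) < t (g j)) →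
      StrictMono (t ∘ g ∘ τ.perm.symm) ∧ Set.range (t ∘ g ∘ τ.perm.symm) = t '' U := by
    intro t ht
    refine ⟨fun a b hab => (ht _ _).1 (by simpa using hab), ?_⟩
    rw [← Function.comp_assoc, τ.perm.symm.surjective.range_comp, Set.range_comp, hr]
  have he := ((hm hY).1.range_inj (hm hY').1).1
    ((hm hY).2.trans (hV.trans (hm hY').2.symm))
  intro i hi
  obtain ⟨a, rfl⟩ : i ∈ Set.range g := by rw [hr]; exact hi
  simpa using congrFun he (τ.perm a)

/-- The complement pattern is used first: it occupies the complementary values, so it fixes the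
origin and all values off `T`. Only then are the values occupied by `insert o T` known, and the
second pattern fixes those on `T`. -/
theorem eq_of_isSub {n : ℕ} {s s' : Equiv.Perm (Fin (n + 1))} {o o' : Fin (n + 1)}
    {T : Finset (Fin (n + 1))} {τ ρ : CentredPerm} (ho : o ∉ T)
    (h₁ : IsSub τ s o Tᶜ) (h₁' : IsSub τ s' o' Tᶜ)
    (h₂ : IsSub ρ s o (insert o T)) (h₂' : IsSub ρ s' o' (insert o' T))
    (hV : T.image s = T.image s') : s = s' ∧ o = o' := by
  have hV : s '' T = s' '' T := by
    have := congrArg (fun V : Finset (Fin (n + 1)) => (V : Set (Fin (n + 1)))) hV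
    simpa only [Finset.coe_image] using this
  obtain ⟨rfl, h⟩ := h₁.unique h₁' (by
    rw [Finset.coe_compl, Set.image_compl_eq s.bijective, Set.image_compl_eq s'.bijective, hV])
  have h0 : s o = s' o := h o (by simpa using ho)
  obtain ⟨-, h'⟩ := h₂.unique h₂' (by
    rw [Finset.coe_insert, Set.image_insert_eq, Set.image_insert_eq, hV, h0])
  refine ⟨?_, rfl⟩
  ext1 i
  by_cases hi : i ∈ T
  · exact h' i (Finset.mem_insert_of_mem hi)
  · exact h i (by simpa using hi)

theorem PinSequence.exists_deletion (w : PinSequence) (m : ℕ) :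
    ∃ K, ∀ (n : ℕ) (s : Equiv.Perm (Fin (n + 1))) (o : Fin (n + 1)),
      (⟨n, s, o⟩ : CentredPerm) ∈ w.centredPinClass → ∃ T : Finset (Fin (n + 1)), o ∉ T ∧
      T.card ≤ n / (m + 2) + K ∧ ∀ τ, IsSub τ s o Tᶜ → τ ∈ w.boxInterior := by
  obtain ⟨N, hN⟩ := w.eventually_recurrent m
  refine ⟨(m + 2) * (N + 1), fun n s o hσ => ?_⟩
  generalize hK : (m + 2) * (N + 1) = K
  obtain ⟨f, hf, hX, hY, hfo⟩ := (w.mem_centredPinClass_iff _).1 hσ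
  let g : Fin (n + 1) → ℕ := fun i => (f i).1
  have hg : Function.Injective g := fun i j hij => hf (Subtype.ext hij)
  have hgo : g o = 0 := congrArg (Subtype.val : {j : ℕ // j = 0 ∨ j ∈ Set.univ} → ℕ) hfo
  -- Pigeonhole: the `n` points other than the origin fall into `m + 2` residue classes.
  obtain ⟨r, hr, hcard⟩ := Finset.exists_card_fiber_lt_of_card_lt_mul
    (s := Finset.univ.erase o) (t := Finset.range (m + 2)) (f := fun i => g i % (m + 2))
    (n := n / (m + 2) + 1) (by
      rw [Finset.card_erase_of_mem (Finset.mem_univ _), Finset.card_univ, Fintype.card_fin,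
        Finset.card_range, Nat.add_sub_cancel]
      exact Nat.lt_mul_div_succ n (by omega))
  have hsmall : ((Finset.univ.erase o).filter fun i => g i ≤ K).card ≤ K := by
    have := Finset.card_le_card_of_injOn (s := (Finset.univ.erase o).filter fun i => g i ≤ K)
      (t := Finset.Icc 1 K) g (fun i hi => by
        simp only [Finset.coe_filter, Finset.mem_erase, Finset.mem_univ, and_true,
          Set.mem_ofPred_eq] at hi
        have : g i ≠ 0 := fun h => hi.1 (hg (h.trans hgo.symm))
        simp only [Finset.coe_Icc, Set.mem_Icc]
        omega) hg.injOn
    simpa using this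
  refine ⟨((Finset.univ.erase o).filter fun i => g i % (m + 2) = r) ∪
    ((Finset.univ.erase o).filter fun i => g i ≤ K), by simp, ?_, fun τ hτ => ?_⟩
  · exact (Finset.card_union_le _ _).trans (by omega)
  · obtain ⟨h, hh, hrange, ho, hYτ⟩ := hτ
    refine w.mem_boxInterior_of_le hN (Finset.mem_range.1 hr) ?_
    refine ⟨fun i => ⟨g (h i), ?_⟩, fun i j hij => hh.injective (hg ?_),
      fun i j => hh.lt_iff_lt.symm.trans (hX _ _), fun i j => (hYτ i j).trans (hY _ _),
      Subtype.ext ?_⟩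
    · have hi : h i ∈ Set.range h := ⟨i, rfl⟩
      rw [hrange] at hi
      by_cases h0 : h i = o
      · exact Or.inl (by rw [h0, hgo])
      · refine Or.inr ?_
        simp only [Finset.coe_compl, Set.mem_compl_iff, Finset.mem_coe, Finset.mem_union,
          Finset.mem_filter, Finset.mem_erase, Finset.mem_univ, h0, ne_eq, not_false_eq_true,
          true_and, and_true, not_or, not_le] at hi
        exact ⟨hK ▸ hi.2, hi.1⟩
    · exact congrArg (Subtype.val : {j : ℕ // j = 0 ∨
        j ∈ {j | (m + 2) * (N + 1) < j ∧ j % (m + 2) ≠ r}} → ℕ) hij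
    · exact (congrArg g ho).trans hgo

/-- A member of `B` is encoded by `T`, its set of values, the pattern on `T` with the origin, and
the pattern off `T`; `eq_of_isSub` makes this injective. The two binomials count positions and
values. -/
theorem centredEnum_le_sum {A B : Set CentredPerm} (n J : ℕ)
    (hB : ∀ π σ : CentredPerm, Le π.cfg σ.cfg → σ ∈ B → π ∈ B)
    (h : ∀ (s : Equiv.Perm (Fin (n + 1))) (o : Fin (n + 1)), (⟨n, s, o⟩ : CentredPerm) ∈ B →
      ∃ T : Finset (Fin (n + 1)), o ∉ T ∧ T.card ≤ J ∧ ∀ τ, IsSub τ s o Tᶜ → τ ∈ A) :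
    centredEnum B n ≤ ∑ j ∈ Finset.range (J + 1),
      (n + 1).choose j * (n + 1).choose j * (centredEnum B j * centredEnum A (n - j)) := by
  have hex : ∀ σ : CentredPerm, ∃ x : (Finset (Fin (n + 1)) × Finset (Fin (n + 1))) ×
      (CentredPerm × CentredPerm), σ ∈ B → σ.length = n →
      ∃ s o, σ = ⟨n, s, o⟩ ∧ x.1.2 = x.1.1.image s ∧ o ∉ x.1.1 ∧ x.1.1.card ≤ J ∧
        x.2.1 ∈ B ∧ x.2.1.length = x.1.1.card ∧ x.2.2 ∈ A ∧ x.2.2.length = n - x.1.1.card ∧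
        IsSub x.2.1 s o (insert o x.1.1) ∧ IsSub x.2.2 s o x.1.1ᶜ := by
    intro σ
    by_cases hσ : σ ∈ B ∧ σ.length = n
    · obtain ⟨hσ, rfl⟩ := hσ
      obtain ⟨T, ho, hT, hA⟩ := h σ.perm σ.origin hσ
      obtain ⟨ρ, hρ, hρs⟩ := exists_isSub σ.perm (U := insert σ.origin T)
        (Finset.mem_insert_self _ _) (Finset.card_insert_of_notMem ho)
      have hc : T.card + Tᶜ.card = σ.length + 1 := by
        rw [Finset.card_add_card_compl, Fintype.card_fin]
      have hpos : 0 < Tᶜ.card := Finset.card_pos.2 ⟨_, Finset.mem_compl.2 ho⟩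
      obtain ⟨τ, hτ, hτs⟩ := exists_isSub σ.perm (U := Tᶜ) (l := σ.length - T.card)
        (Finset.mem_compl.2 ho) (by omega)
      exact ⟨((T, T.image σ.perm), ρ, τ), fun _ _ => ⟨σ.perm, σ.origin, rfl, rfl, ho, hT,
        hB _ _ hρs.le hσ, hρ, hA τ hτs, hτ, hρs, hτs⟩⟩
    · exact ⟨((∅, ∅), CentredPerm.trivial, CentredPerm.trivial),
        fun h1 h2 => absurd ⟨h1, h2⟩ hσ⟩
  choose F hF using hex
  let fB : ℕ → Finset CentredPerm := fun j => (finite_centred B j).toFinset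
  let fA : ℕ → Finset CentredPerm := fun j => (finite_centred A j).toFinset
  have hcB : ∀ j, (fB j).card = centredEnum B j := fun j =>
    (Set.ncard_eq_toFinset_card _ (finite_centred B j)).symm
  have hcA : ∀ j, (fA j).card = centredEnum A j := fun j =>
    (Set.ncard_eq_toFinset_card _ (finite_centred A j)).symm
  let P : ℕ → Finset (Finset (Fin (n + 1))) := fun j => Finset.powersetCard j Finset.univ
  have hP : ∀ j, (P j).card = (n + 1).choose j := fun j => by simp [P]
  classical
  calc centredEnum B n = (fB n).card := (hcB n).symm
    _ ≤ ((Finset.range (J + 1)).biUnion fun j => (P j ×ˢ P j) ×ˢ (fB j ×ˢ fA (n - j))).card := by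
      refine Finset.card_le_card_of_injOn F (fun σ hσ => ?_) (fun σ hσ σ' hσ' he => ?_)
      · have hσ : σ ∈ B ∧ σ.length = n := by simpa [fB] using hσ
        obtain ⟨s, o, -, hi, ho, hJ, h1, h2, h3, h4, -, -⟩ := hF σ hσ.1 hσ.2
        simp only [Finset.coe_biUnion, Set.mem_iUnion, Finset.mem_coe, Finset.mem_product]
        refine ⟨(F σ).1.1.card, Finset.mem_range.2 (by omega), ⟨?_, ?_⟩, ?_, ?_⟩
        · simp [P]
        · simp [P, hi, Finset.card_image_of_injective _ s.injective]
        · simpa [fB] using ⟨h1, h2⟩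
        · simpa [fA] using ⟨h3, h4⟩
      · have hσ : σ ∈ B ∧ σ.length = n := by simpa [fB] using hσ
        have hσ' : σ' ∈ B ∧ σ'.length = n := by simpa [fB] using hσ'
        obtain ⟨s, o, e, hi, ho, -, -, -, -, -, h1, h2⟩ := hF σ hσ.1 hσ.2
        obtain ⟨s', o', e', hi', -, -, -, -, -, -, h1', h2'⟩ := hF σ' hσ'.1 hσ'.2
        rw [he] at h1 h2 hi ho
        obtain ⟨hs, ho⟩ := eq_of_isSub ho h2 h2' h1 h1' (hi.symm.trans hi')
        rw [e, e', hs, ho]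
    _ ≤ ∑ j ∈ Finset.range (J + 1), ((P j ×ˢ P j) ×ˢ (fB j ×ˢ fA (n - j))).card :=
      Finset.card_biUnion_le
    _ = _ := by simp only [Finset.card_product, hcB, hcA, hP]

theorem PinSequence.exists_centredEnum_le_sum (w : PinSequence) (m : ℕ) :
    ∃ K, ∀ n, centredEnum w.centredPinClass n ≤ ∑ j ∈ Finset.range (n / (m + 2) + K + 1),
      (n + 1).choose j * (n + 1).choose j *
        (centredEnum w.centredPinClass j * centredEnum w.boxInterior (n - j)) := by
  obtain ⟨K, hK⟩ := w.exists_deletion m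
  exact ⟨K, fun n => centredEnum_le_sum n _ (fun π σ h hσ =>
    (w.mem_centredPinClass_iff π).2 (h.trans ((w.mem_centredPinClass_iff σ).1 hσ))) (hK n)⟩

/-! ### Growth rates -/

open scoped Topology

theorem hasGrowthRate_of_tendsto_log {c : ℕ → ℕ} (hc : ∀ n, 1 ≤ c n) {L : ℝ}
    (h : Tendsto (fun n : ℕ => Real.log (c n) / n) atTop (𝓝 L)) :
    HasGrowthRate c (Real.exp L).toNNReal := by
  have key : Tendsto (fun n : ℕ => (c n : ℝ≥0∞) ^ (1 / (n : ℝ))) atTop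
      (𝓝 (((Real.exp L).toNNReal : ℝ≥0) : ℝ≥0∞)) := by
    have h1 := ENNReal.tendsto_ofReal ((Real.continuous_exp.tendsto L).comp h)
    refine h1.congr fun n => ?_
    have hpos : (0 : ℝ) < c n := by exact_mod_cast hc n
    rw [← ENNReal.ofReal_natCast (c n), ENNReal.ofReal_rpow_of_pos hpos,
      Real.rpow_def_of_pos hpos]
    simp [div_eq_mul_inv]
  exact ⟨key.liminf_eq, key.limsup_eq⟩

theorem tendsto_log_add_div (c : ℝ) :
    Tendsto (fun n : ℕ => Real.log ((n : ℝ) + c) / n) atTop (𝓝 0) := by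
  have h0 : Tendsto (fun n : ℕ => (n : ℝ) + c) atTop atTop :=
    tendsto_atTop_add_const_right _ c tendsto_natCast_atTop_atTop
  have h1 : Tendsto (fun x : ℝ => Real.log x / x) atTop (𝓝 0) :=
    Real.isLittleO_log_id_atTop.tendsto_div_nhds_zero
  have h2 : Tendsto (fun n : ℕ => 1 + c / (n : ℝ)) atTop (𝓝 (1 + 0)) :=
    tendsto_const_nhds.add (tendsto_const_div_atTop_nhds_zero_nat c)
  have h3 := (h1.comp h0).mul h2
  rw [zero_mul] at h3
  refine h3.congr' ?_
  filter_upwards [eventually_gt_atTop 0, h0.eventually_gt_atTop 0] with n hn hn'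
  have : (n : ℝ) ≠ 0 := by exact_mod_cast hn.ne'
  simp only [Function.comp]
  field_simp

/-- Fekete's lemma applies once the polynomial factor is absorbed. The correction `log 4 + 2 * log
(n + 1)` in `v` does this: for `m ≤ n`, `m + n + 1 ≤ 2 * (n + 1)` and `m + 1 ≤ (m + 1) ^ 2`; the
other case follows by symmetry. -/
theorem tendsto_log_div_of_supermultiplicative {a : ℕ → ℕ} (ha : ∀ n, 1 ≤ a n)
    (hmul : ∀ m n, a m * a n ≤ (m + 1) * a (m + n)) (hb : ∀ n, a n ≤ 16 ^ (n + 1)) :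
    ∃ L, Tendsto (fun n : ℕ => Real.log (a n) / n) atTop (𝓝 L) := by
  have hpos : ∀ n, (0 : ℝ) < a n := fun n => by exact_mod_cast ha n
  let v : ℕ → ℝ := fun n => Real.log 4 + 2 * Real.log ((n : ℝ) + 1) - Real.log (a n)
  have key1 : ∀ m n, m ≤ n → (m + n + 1) ^ 2 * (a m * a n) ≤
      4 * (m + 1) ^ 2 * (n + 1) ^ 2 * a (m + n) := by
    intro m n hmn
    calc (m + n + 1) ^ 2 * (a m * a n) ≤ (2 * (n + 1)) ^ 2 * ((m + 1) * a (m + n)) := by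
          exact Nat.mul_le_mul (Nat.pow_le_pow_left (by omega) 2) (hmul m n)
      _ ≤ (2 * (n + 1)) ^ 2 * ((m + 1) ^ 2 * a (m + n)) := by
          gcongr
          exact Nat.le_self_pow two_ne_zero _
      _ = _ := by ring
  have key : ∀ m n, (m + n + 1) ^ 2 * (a m * a n) ≤
      4 * (m + 1) ^ 2 * (n + 1) ^ 2 * a (m + n) := by
    intro m n
    rcases le_total m n with h | h
    · exact key1 m n h
    · have := key1 n m h
      rw [add_comm n m] at this
      linarith
  have hsub : Subadditive v := by
    intro m n
    have h1 : (((m : ℝ) + n + 1) ^ 2 * (a m * a n)) ≤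
      4 * ((m : ℝ) + 1) ^ 2 * ((n : ℝ) + 1) ^ 2 * a (m + n) := by exact_mod_cast key m n
    have h2 := Real.log_le_log (by have := hpos m; have := hpos n; positivity) h1
    have := (hpos m).ne'
    have := (hpos n).ne'
    have := (hpos (m + n)).ne'
    rw [Real.log_mul (by positivity) (by positivity), Real.log_mul (by positivity) (by positivity),
      Real.log_mul (by positivity) (by positivity), Real.log_mul (by positivity) (by positivity),
      Real.log_mul (by positivity) (by positivity), Real.log_pow, Real.log_pow,
      Real.log_pow] at h2
    simp only [v]
    push_cast at h2 ⊢
    have : Real.log 4 ≥ 0 := Real.log_nonneg (by norm_num)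
    linarith
  have hlog : ∀ n, Real.log (a n) ≤ (n + 1) * Real.log 16 := by
    intro n
    have : (a n : ℝ) ≤ 16 ^ (n + 1) := by exact_mod_cast hb n
    have := Real.log_le_log (hpos n) this
    rw [Real.log_pow] at this
    exact_mod_cast this
  have h16 : 0 ≤ Real.log 16 := Real.log_nonneg (by norm_num)
  have hbdd : BddBelow (Set.range fun n : ℕ => v n / n) := by
    refine ⟨-(2 * Real.log 16), ?_⟩
    rintro _ ⟨n, rfl⟩
    simp only
    rcases Nat.eq_zero_or_pos n with rfl | hn
    · simp only [Nat.cast_zero, div_zero]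
      linarith
    · have hn' : (1 : ℝ) ≤ n := by exact_mod_cast hn
      rw [le_div_iff₀ (by linarith)]
      have h4 : 0 ≤ Real.log 4 := Real.log_nonneg (by norm_num)
      have h5 : 0 ≤ Real.log ((n : ℝ) + 1) := Real.log_nonneg (by linarith)
      have := hlog n
      simp only [v]
      nlinarith
  have h1 := hsub.tendsto_lim hbdd
  refine ⟨0 + 2 * 0 - hsub.lim, ?_⟩
  refine (((tendsto_const_div_atTop_nhds_zero_nat (Real.log 4)).add
    ((tendsto_log_add_div 1).const_mul 2)).sub h1).congr fun n => ?_
  simp only [v]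
  ring

/-- One term of the binomial expansion of `(1 + x) ^ N`. For small `x` and `J` small compared with
`N`, this is an exponential bound with rate close to 1. -/
theorem choose_le_of_pos (N : ℕ) {j J : ℕ} (hj : j ≤ J) {x : ℝ} (hx : 0 < x) (hx1 : x ≤ 1) :
    (N.choose j : ℝ) ≤ (1 + x) ^ N * (1 / x) ^ J := by
  have h1 : x ^ j * (N.choose j : ℝ) ≤ (1 + x) ^ N := by
    by_cases hN : j ≤ N
    · rw [add_comm, add_pow]
      have := Finset.single_le_sum (f := fun i => x ^ i * 1 ^ (N - i) * (N.choose i : ℝ))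
        (fun i _ => by positivity) (Finset.mem_range.2 (Nat.lt_succ_of_le hN))
      simpa using this
    · rw [Nat.choose_eq_zero_of_lt (not_le.1 hN)]
      simp only [Nat.cast_zero, mul_zero]
      positivity
  have h2 : x ^ J * (N.choose j : ℝ) ≤ (1 + x) ^ N :=
    (mul_le_mul_of_nonneg_right (pow_le_pow_of_le_one hx.le hx1 hj) (by positivity)).trans h1
  rw [one_div, inv_pow, ← div_eq_mul_inv, le_div_iff₀ (by positivity), mul_comm]
  exact h2

/-- After taking logarithms and dividing by `n`, the error is at most `2 * x + (2 * log (1 / x) +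
log 16) / (m + 2)` plus a term tending to `0`. Choosing `x` first and then `m` makes it arbitrarily
small. -/
theorem tendsto_log_div_sub {a b : ℕ → ℕ} (ha : ∀ n, 1 ≤ a n)
    (hmul : ∀ m n, a m * a n ≤ (m + 1) * a (m + n)) (hab : ∀ n, a n ≤ b n)
    (hb : ∀ n, b n ≤ 16 ^ (n + 1))
    (hsum : ∀ m, ∃ K, ∀ n, b n ≤ ∑ j ∈ Finset.range (n / (m + 2) + K + 1),
      (n + 1).choose j * (n + 1).choose j * (b j * a (n - j))) :
    Tendsto (fun n : ℕ => (Real.log (b n) - Real.log (a n)) / n) atTop (𝓝 0) := by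
  have hpos : ∀ n, (0 : ℝ) < a n := fun n => by exact_mod_cast ha n
  have hposb : ∀ n, (0 : ℝ) < b n := fun n => by exact_mod_cast (ha n).trans (hab n)
  have h16 : 0 ≤ Real.log 16 := Real.log_nonneg (by norm_num)
  have haj : ∀ n j, a (n - j) ≤ (n + 1) * a n := by
    intro n j
    -- The second argument is not `j`, since `j` may exceed `n`.
    have h1 := hmul (n - j) (n - (n - j))
    rw [show n - j + (n - (n - j)) = n by omega] at h1
    calc a (n - j) ≤ a (n - j) * a (n - (n - j)) := Nat.le_mul_of_pos_right _ (ha _)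
      _ ≤ _ := h1
      _ ≤ _ := by gcongr; omega
  have key : ∀ x : ℝ, 0 < x → x ≤ 1 → ∀ m : ℕ, ∃ K : ℕ, ∀ n : ℕ,
      Real.log (b n) - Real.log (a n) ≤ Real.log ((n : ℝ) + (K + 1)) + Real.log ((n : ℝ) + 1) +
      2 * (n + 1) * x + ((n : ℝ) / (m + 2 : ℕ) + (K + 1)) *
        (2 * Real.log (1 / x) + Real.log 16) := by
    intro x hx hx1 m
    obtain ⟨K, hK⟩ := hsum m
    refine ⟨K, fun n => ?_⟩
    have hX : 0 ≤ Real.log (1 / x) := Real.log_nonneg (by rwa [le_div_iff₀ hx, one_mul])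
    generalize hJ : n / (m + 2) + K = J
    have hJn : J ≤ n + K := by
      have := Nat.div_le_self n (m + 2)
      omega
    have hJr : (J : ℝ) ≤ (n : ℝ) / (m + 2 : ℕ) + K := by
      rw [← hJ, Nat.cast_add]
      gcongr
      exact Nat.cast_div_le
    have h1 : (b n : ℝ) ≤ ((n : ℝ) + (K + 1)) * ((((1 + x) ^ (n + 1) * (1 / x) ^ J) *
        ((1 + x) ^ (n + 1) * (1 / x) ^ J)) * (16 ^ (J + 1) * (((n : ℝ) + 1) * a n))) := by
      calc (b n : ℝ) ≤ ∑ j ∈ Finset.range (J + 1), (((n + 1).choose j : ℝ) * (n + 1).choose j *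
            (b j * a (n - j))) := by
            have := hK n
            rw [hJ] at this
            exact_mod_cast this
        _ ≤ ∑ j ∈ Finset.range (J + 1), ((((1 + x) ^ (n + 1) * (1 / x) ^ J) *
            ((1 + x) ^ (n + 1) * (1 / x) ^ J)) * (16 ^ (J + 1) * (((n : ℝ) + 1) * a n))) := by
            refine Finset.sum_le_sum fun j hj => ?_
            have hj : j ≤ J := Nat.lt_succ_iff.1 (Finset.mem_range.1 hj)
            have hc := choose_le_of_pos (n + 1) hj hx hx1
            have hbj : (b j : ℝ) ≤ 16 ^ (J + 1) := by
              have : b j ≤ 16 ^ (J + 1) :=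
                (hb j).trans (Nat.pow_le_pow_right (by norm_num) (by omega))
              exact_mod_cast this
            have hajr : (a (n - j) : ℝ) ≤ ((n : ℝ) + 1) * a n := by exact_mod_cast haj n j
            gcongr
        _ = ((J + 1 : ℕ) : ℝ) * _ := by rw [Finset.sum_const, Finset.card_range, nsmul_eq_mul]
        _ ≤ _ := by
            have hJ' : ((J + 1 : ℕ) : ℝ) ≤ (n : ℝ) + (K + 1) := by
              have : J + 1 ≤ n + (K + 1) := by omega
              exact_mod_cast this
            have := (hpos n).le
            gcongr
    have h2 := Real.log_le_log (hposb n) h1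
    have := (hpos n).ne'
    rw [Real.log_mul (by positivity) (by positivity), Real.log_mul (by positivity) (by positivity),
      Real.log_mul (by positivity) (by positivity), Real.log_mul (by positivity) (by positivity),
      Real.log_mul (by positivity) (by positivity), Real.log_mul (by positivity) (by positivity),
      Real.log_pow, Real.log_pow, Real.log_pow] at h2
    have h3 : Real.log (1 + x) ≤ x := by
      have := Real.log_le_sub_one_of_pos (show 0 < 1 + x by linarith)
      linarith
    have h4 : ((n : ℝ) + 1) * Real.log (1 + x) ≤ (n + 1) * x := by gcongr
    have h5 : ((J : ℝ) + 1) * (2 * Real.log (1 / x) + Real.log 16) ≤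
        ((n : ℝ) / (m + 2 : ℕ) + (K + 1)) * (2 * Real.log (1 / x) + Real.log 16) := by
      refine mul_le_mul_of_nonneg_right (by linarith) (by linarith)
    push_cast at h2 h5 ⊢
    linarith
  refine tendsto_order.2 ⟨fun ε hε => ?_, fun ε hε => ?_⟩
  · refine Eventually.of_forall fun n => lt_of_lt_of_le hε ?_
    have : Real.log (a n) ≤ Real.log (b n) :=
      Real.log_le_log (hpos n) (by exact_mod_cast hab n)
    exact div_nonneg (by linarith) (Nat.cast_nonneg n)
  -- Three quarters of `ε` are spent: on `x`, on `m`, and on the terms that vanish as `n` grows.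
  · obtain ⟨x, hx, hx1, hxε⟩ : ∃ x : ℝ, 0 < x ∧ x ≤ 1 ∧ 2 * x ≤ ε / 4 :=
      ⟨min 1 (ε / 8), lt_min one_pos (by linarith), min_le_left _ _, by
        have := min_le_right 1 (ε / 8)
        linarith⟩
    set c := 2 * Real.log (1 / x) + Real.log 16 with hc
    obtain ⟨m, hm⟩ : ∃ m : ℕ, c / (m + 2 : ℕ) < ε / 4 :=
      ((((tendsto_const_div_atTop_nhds_zero_nat c).comp (tendsto_add_atTop_nat 2)).eventually
        (gt_mem_nhds (show 0 < ε / 4 by linarith)))).exists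
    obtain ⟨K, hK⟩ := key x hx hx1 m
    have hlim := (((tendsto_log_add_div (K + 1)).add (tendsto_log_add_div 1)).add
      (tendsto_const_div_atTop_nhds_zero_nat (2 * x))).add
      (tendsto_const_div_atTop_nhds_zero_nat ((K + 1) * c))
    simp only [add_zero] at hlim
    filter_upwards [hlim.eventually (gt_mem_nhds (show 0 < ε / 4 by linarith)),
      eventually_gt_atTop 0] with n hn hn0
    have hn0 : (0 : ℝ) < n := by exact_mod_cast hn0
    have h1 := div_le_div_of_nonneg_right (hK n) hn0.le
    refine h1.trans_lt ?_
    have h2 : (Real.log ((n : ℝ) + (K + 1)) + Real.log ((n : ℝ) + 1) + 2 * (n + 1) * x +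
        ((n : ℝ) / (m + 2 : ℕ) + (K + 1)) * c) / n =
        (Real.log ((n : ℝ) + (K + 1)) / n + Real.log ((n : ℝ) + 1) / n + 2 * x / n +
          (K + 1) * c / n) + 2 * x + c / (m + 2 : ℕ) := by
      field_simp
      ring
    rw [h2]
    linarith

theorem exists_growthRate {a b u : ℕ → ℕ} (ha : ∀ n, 1 ≤ a n)
    (hmul : ∀ m n, a m * a n ≤ (m + 1) * a (m + n)) (hab : ∀ n, a n ≤ b n)
    (hb : ∀ n, b n ≤ 16 ^ (n + 1))
    (hsum : ∀ m, ∃ K, ∀ n, b n ≤ ∑ j ∈ Finset.range (n / (m + 2) + K + 1),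
      (n + 1).choose j * (n + 1).choose j * (b j * a (n - j)))
    (hub : ∀ n, u n ≤ b n) (hbu : ∀ n, b n ≤ u n * ((n + 1) * (n + 1))) :
    ∃ ρ : ℝ≥0, HasGrowthRate b ρ ∧ HasGrowthRate u ρ ∧ HasGrowthRate a ρ := by
  obtain ⟨L, hL⟩ := tendsto_log_div_of_supermultiplicative ha hmul fun n => (hab n).trans (hb n)
  have hb1 : ∀ n, 1 ≤ b n := fun n => (ha n).trans (hab n)
  have hu1 : ∀ n, 1 ≤ u n := fun n => by
    have := (hb1 n).trans (hbu n)
    by_contra h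
    simp [show u n = 0 by omega] at this
  have hLb : Tendsto (fun n : ℕ => Real.log (b n) / n) atTop (𝓝 L) := by
    have := hL.add (tendsto_log_div_sub ha hmul hab hb hsum)
    rw [add_zero] at this
    exact this.congr fun n => by ring
  have hLu : Tendsto (fun n : ℕ => Real.log (u n) / n) atTop (𝓝 L) := by
    have hlow := hLb.sub ((tendsto_log_add_div 1).const_mul 2)
    rw [mul_zero, sub_zero] at hlow
    refine tendsto_of_tendsto_of_tendsto_of_le_of_le hlow hLb (fun n => ?_) fun n => ?_
    · have hpu : (0 : ℝ) < u n := by exact_mod_cast hu1 n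
      have hpb : (0 : ℝ) < b n := by exact_mod_cast hb1 n
      have h1 : (b n : ℝ) ≤ u n * (((n : ℝ) + 1) * (n + 1)) := by exact_mod_cast hbu n
      have h2 := Real.log_le_log hpb h1
      rw [Real.log_mul (by positivity) (by positivity),
        Real.log_mul (by positivity) (by positivity)] at h2
      simp only
      rw [← mul_div_assoc, ← sub_div]
      exact div_le_div_of_nonneg_right (by linarith) (Nat.cast_nonneg n)
    · refine div_le_div_of_nonneg_right (Real.log_le_log ?_ ?_) (Nat.cast_nonneg n)
      · exact_mod_cast hu1 n
      · exact_mod_cast hub n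
  exact ⟨_, hasGrowthRate_of_tendsto_log hb1 hLb, hasGrowthRate_of_tendsto_log hu1 hLu,
    hasGrowthRate_of_tendsto_log ha hL⟩

end PinClasses

/-- For every pin sequence `w`, the centred pin class, the uncentred pin class and the
`⊞`-interior all have a proper growth rate, and these growth rates coincide. -/
theorem mainTheorem1 (w : PinClasses.PinSequence) :
    ∃ ρ : ℝ≥0,
      PinClasses.HasGrowthRate (PinClasses.centredEnum w.centredPinClass) ρ ∧
      PinClasses.HasGrowthRate (PinClasses.uncentredEnum w.pinClass) ρ ∧
      PinClasses.HasGrowthRate (PinClasses.centredEnum w.boxInterior) ρ :=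
  PinClasses.exists_growthRate w.centredEnum_boxInterior_pos
    (PinClasses.centredEnum_mul_le (PinClasses.boxClosure_closed _))
    w.centredEnum_boxInterior_le w.centredEnum_le_pow w.exists_centredEnum_le_sum
    w.uncentredEnum_le w.centredEnum_le_uncentred
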